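/- Let $M$ be a smooth manifold of dimension $d\ge 2$ with a smooth Riemannian metric $\mathfrak g$ and a smooth weight $W:M\to\mathbb R$. Let $d\mu=e^{-W}dV_{\mathfrak g}$, where $V_{\mathfrak g}$ is the Riemannian volume, let $\Gamma(f)=|\nabla_{\mathfrak g}f|_{\mathfrak g}^2$ be the carré du champ operator, with associated bilinear form $\Gamma(f,h)=\mathfrak g(\nabla_{\mathfrak g}f,\nabla_{\mathfrak g}h)$, and let $L=\Delta_{\mathfrak g}-\Gamma(W,\cdot)$. The pair $(\mu,\Gamma)$ determines $\mathfrak g$, $W$ and $L$. For a real number $n$, the $n$-conformal class of $(\mu,\Gamma)$ is the set of all pairs $(c^{-n}\mu,c^2\Gamma)$ with $c:M\to(0,\infty)$ smooth; each of them is again the pair of a smooth metric and a smooth weight on $M$. An $n$-conformal invariant is a map $S$ from this class to the functions on $M$ such that, for every pair $(\mu,\Gamma)$ in the class (with its own $L$) and every smooth positive function $c=e^{\tau}$, $$S(c^{-n}\mu,c^2\Gamma)=c^2\Big[S(\mu,\Gamma)+\frac{n-2}{2}\Big(L\tau-\frac{n-2}{2}\Gamma(\tau)\Big)\Big].$$ Let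 $n>d$ be a real number and let $\gamma\in\mathbb R$ satisfy $4(d-1)-2\gamma(n-d)\neq 0$. Set $$\beta_n(\gamma)=\frac{\gamma(n-2d+2)-2(d-1)}{2(n-d)},\qquad \theta_n(\gamma)=\frac{n-2}{4(d-1)-2\gamma(n-d)}.$$ Then $$S_\gamma(\mu,\Gamma)=\theta_n(\gamma)\big[sc_{\mathfrak g}-\gamma\,\Delta_{\mathfrak g}W+\beta_n(\gamma)\,\Gamma(W)\big],$$ where $sc_{\mathfrak g}$ is the scalar curvature of $\mathfrak g$, is well defined as a function of the pair $(\mu,\Gamma)$ and is an $n$-conformal invariant. -/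

import Mathlib

open MeasureTheory Manifold
open scoped ContDiff

namespace WeightedManifold

noncomputable section

/-- The smooth real-valued functions on a `d`-dimensional manifold. -/
abbrev SmoothFun (d : ℕ) (M : Type*) [TopologicalSpace M]
    [ChartedSpace (EuclideanSpace ℝ (Fin d)) M] :=
  ContMDiffMap (𝓡 d) 𝓘(ℝ, ℝ) M ℝ ∞

/-- The smooth Riemannian metrics on a smooth `d`-dimensional manifold. -/
abbrev SmoothMetric (d : ℕ) (M : Type*) [TopologicalSpace M]
    [ChartedSpace (EuclideanSpace ℝ (Fin d)) M] [IsManifold (𝓡 d) ∞ M] :=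
  Bundle.ContMDiffRiemannianMetric (𝓡 d) ∞ (EuclideanSpace ℝ (Fin d))
    (fun x : M ↦ TangentSpace (𝓡 d) x)

/-- The partial derivative `∂_k F` of a function on `ℝᵈ`. -/
def pderiv {d : ℕ} (k : Fin d) (F : EuclideanSpace ℝ (Fin d) → ℝ)
    (y : EuclideanSpace ℝ (Fin d)) : ℝ :=
  fderiv ℝ F y (EuclideanSpace.single k 1)

/-! ### Riemannian quantities of a metric `G = (G_ij)` given on an open subset of `ℝᵈ` -/

/-- Christoffel symbols
`Γ^k_{ij} = ½ ∑_l G^{kl} (∂_i G_{jl} + ∂_j G_{il} - ∂_l G_{ij})`. -/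
def christoffel {d : ℕ} (G : EuclideanSpace ℝ (Fin d) → Matrix (Fin d) (Fin d) ℝ)
    (k i j : Fin d) (y : EuclideanSpace ℝ (Fin d)) : ℝ :=
  (1 / 2 : ℝ) * ∑ l, (G y)⁻¹ k l *
    (pderiv i (fun z ↦ G z j l) y + pderiv j (fun z ↦ G z i l) y - pderiv l (fun z ↦ G z i j) y)

/-- Ricci curvature
`R_{ij} = ∑_k (∂_k Γ^k_{ij} - ∂_j Γ^k_{ik}) + ∑_{k,l} (Γ^k_{kl} Γ^l_{ij} - Γ^k_{jl} Γ^l_{ik})`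
(the sign for which round spheres have positive curvature). -/
def ricci {d : ℕ} (G : EuclideanSpace ℝ (Fin d) → Matrix (Fin d) (Fin d) ℝ)
    (i j : Fin d) (y : EuclideanSpace ℝ (Fin d)) : ℝ :=
  (∑ k, (pderiv k (christoffel G k i j) y - pderiv j (christoffel G k i k) y)) +
    ∑ k, ∑ l, (christoffel G k k l y * christoffel G l i j y -
      christoffel G k j l y * christoffel G l i k y)

/-- Scalar curvature `∑_{i,j} G^{ij} R_{ij}`. -/
def localScalarCurvature {d : ℕ} (G : EuclideanSpace ℝ (Fin d) → Matrix (Fin d) (Fin d) ℝ)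
    (y : EuclideanSpace ℝ (Fin d)) : ℝ :=
  ∑ i, ∑ j, (G y)⁻¹ i j * ricci G i j y

/-- Laplace-Beltrami operator (trace of the Hessian)
`∑_{i,j} G^{ij} (∂_i ∂_j F - ∑_k Γ^k_{ij} ∂_k F)`. -/
def localLaplacian {d : ℕ} (G : EuclideanSpace ℝ (Fin d) → Matrix (Fin d) (Fin d) ℝ)
    (F : EuclideanSpace ℝ (Fin d) → ℝ) (y : EuclideanSpace ℝ (Fin d)) : ℝ :=
  ∑ i, ∑ j, (G y)⁻¹ i j *
    (pderiv i (pderiv j F) y - ∑ k, christoffel G k i j y * pderiv k F y)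

/-- Scalar product of gradients `∑_{i,j} G^{ij} ∂_i F ∂_j H`. -/
def localGradInner {d : ℕ} (G : EuclideanSpace ℝ (Fin d) → Matrix (Fin d) (Fin d) ℝ)
    (F H : EuclideanSpace ℝ (Fin d) → ℝ) (y : EuclideanSpace ℝ (Fin d)) : ℝ :=
  ∑ i, ∑ j, (G y)⁻¹ i j * (pderiv i F y * pderiv j H y)

section Manifold

variable {d : ℕ} {M : Type*} [TopologicalSpace M] [ChartedSpace (EuclideanSpace ℝ (Fin d)) M]

/-- A function on `M` read in the preferred chart at `x`. -/
def inChart (x : M) (f : M → ℝ) (y : EuclideanSpace ℝ (Fin d)) : ℝ :=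
  f ((chartAt (EuclideanSpace ℝ (Fin d)) x).symm y)

variable [IsManifold (𝓡 d) ∞ M]

/-- The matrix `G_ij = g(∂_i, ∂_j)` of the metric `g` in the preferred chart `φ` at `x`, as a
function on the target of `φ`; here `∂_i = d(φ⁻¹)(e_i)` are the coordinate vector fields. -/
def metricInChart (g : SmoothMetric d M) (x : M) (y : EuclideanSpace ℝ (Fin d)) :
    Matrix (Fin d) (Fin d) ℝ :=
  let φ := chartAt (EuclideanSpace ℝ (Fin d)) x
  let coordVec : Fin d → TangentSpace (𝓡 d) (φ.symm y) := fun i ↦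
    mfderiv 𝓘(ℝ, EuclideanSpace ℝ (Fin d)) (𝓡 d) φ.symm y
      (EuclideanSpace.single i (1 : ℝ) : EuclideanSpace ℝ (Fin d))
  Matrix.of fun i j ↦ g.inner (φ.symm y) (coordVec i) (coordVec j)

/-! The following quantities do not depend on coordinates; at each point they are computed in the
preferred chart at that point. -/

/-- The scalar curvature `sc_g`. -/
def scalarCurvature (g : SmoothMetric d M) (x : M) : ℝ :=
  localScalarCurvature (metricInChart g x) (chartAt (EuclideanSpace ℝ (Fin d)) x x)

/-- The Laplace-Beltrami operator `Δ_g`. -/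
def laplacian (g : SmoothMetric d M) (f : M → ℝ) (x : M) : ℝ :=
  localLaplacian (metricInChart g x) (inChart x f) (chartAt (EuclideanSpace ℝ (Fin d)) x x)

/-- The bilinear carré du champ `Γ(f, h) = g(∇f, ∇h)`; in particular `Γ(f, f) = |∇f|²`. -/
def gradInner (g : SmoothMetric d M) (f h : M → ℝ) (x : M) : ℝ :=
  localGradInner (metricInChart g x) (inChart x f) (inChart x h)
    (chartAt (EuclideanSpace ℝ (Fin d)) x x)

variable [MeasurableSpace M]

/-- The measure `√(det G) dy` of the preferred chart `φ` at `x`, transported by `φ⁻¹` to the domain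
of `φ` (and extended by zero to `M`). -/
def chartVolume (g : SmoothMetric d M) (x : M) : Measure M :=
  let φ := chartAt (EuclideanSpace ℝ (Fin d)) x
  Measure.map φ.symm ((volume.restrict φ.target).withDensity
    fun y ↦ ENNReal.ofReal (Real.sqrt (metricInChart g x y).det))

/-- The Riemannian volume `V_g`: the measure which on each chart domain equals `√(det G) dy`. By the
change of variables formula the chart measures agree on overlaps, so that the measure obtained by
gluing them is the least measure that dominates all of them. -/
def riemannianVolume (g : SmoothMetric d M) : Measure M :=
  ⨆ x : M, chartVolume g x

end Manifold

/-- A weighted Riemannian structure on the manifold `M`: a smooth metric `g` and a smooth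
weight `W`. -/
structure WeightedStructure (d : ℕ) (M : Type*) [TopologicalSpace M]
    [ChartedSpace (EuclideanSpace ℝ (Fin d)) M] [IsManifold (𝓡 d) ∞ M] where
  metric : SmoothMetric d M
  weight : SmoothFun d M

/-- Pairs `(μ, Γ)` of a measure on `M` and an operator `f ↦ Γ(f)` on smooth functions. Below, only
the pairs coming from weighted Riemannian structures matter. -/
@[ext] structure MeasureCarre (d : ℕ) (M : Type*) [TopologicalSpace M]
    [ChartedSpace (EuclideanSpace ℝ (Fin d)) M] [MeasurableSpace M] where
  measure : Measure M
  carre : SmoothFun d M → M → ℝ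

section Weighted

variable {d : ℕ} {M : Type*} [TopologicalSpace M] [ChartedSpace (EuclideanSpace ℝ (Fin d)) M]
  [MeasurableSpace M]

/-- The pair `(c^{-n} μ, c² Γ)`. -/
def MeasureCarre.conformal (T : MeasureCarre d M) (n : ℝ) (c : SmoothFun d M) :
    MeasureCarre d M where
  measure := T.measure.withDensity fun x ↦ ENNReal.ofReal (c x ^ (-n))
  carre := fun f x ↦ c x ^ 2 * T.carre f x

/-- The `n`-conformal class of `(μ, Γ)`: all `(c^{-n} μ, c² Γ)` with `c` smooth and positive. -/
def nConformalClass (n : ℝ) (T : MeasureCarre d M) : Set (MeasureCarre d M) :=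
  {T' | ∃ c : SmoothFun d M, (∀ x, 0 < c x) ∧ T' = T.conformal n c}

variable [IsManifold (𝓡 d) ∞ M]

namespace WeightedStructure

/-- The pair `(μ, Γ)` of a weighted manifold: `dμ = e^{-W} dV_g` and `Γ(f) = |∇f|²`. -/
def toPair (X : WeightedStructure d M) : MeasureCarre d M where
  measure := (riemannianVolume X.metric).withDensity fun x ↦
    ENNReal.ofReal (Real.exp (-X.weight x))
  carre := fun f x ↦ gradInner X.metric f f x

/-- The generator `L f = Δ_g f - Γ(W, f)`. -/
def generator (X : WeightedStructure d M) (f : M → ℝ) (x : M) : ℝ :=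
  laplacian X.metric f x - gradInner X.metric X.weight f x

end WeightedStructure

/-- `S` is an `n`-conformal invariant on the `n`-conformal class of (the pair of) `X`: for every
`(μ, Γ)` in this class, with metric and weight those of `Y`, and every smooth positive
`c = e^τ`,
`S(c^{-n} μ, c² Γ) = c² [S(μ, Γ) + (n-2)/2 (L τ - (n-2)/2 Γ(τ))]`. -/
def IsNConformalInvariant (n : ℝ) (X : WeightedStructure d M)
    (S : MeasureCarre d M → M → ℝ) : Prop :=
  ∀ Y : WeightedStructure d M, Y.toPair ∈ nConformalClass n X.toPair →
    ∀ c : SmoothFun d M, (∀ x, 0 < c x) → ∀ τ : SmoothFun d M, (∀ x, c x = Real.exp (τ x)) →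
      ∀ x, S (Y.toPair.conformal n c) x =
        c x ^ 2 * (S Y.toPair x + (n - 2) / 2 *
          (Y.generator τ x - (n - 2) / 2 * gradInner Y.metric τ τ x))

/-- `β_n(γ)`, in dimension `d`. -/
def beta (d : ℕ) (n γ : ℝ) : ℝ :=
  (γ * (n - 2 * d + 2) - 2 * (d - 1)) / (2 * (n - d))

/-- `θ_n(γ)`, in dimension `d`. -/
def theta (d : ℕ) (n γ : ℝ) : ℝ :=
  (n - 2) / (4 * (d - 1) - 2 * γ * (n - d))

/-- `θ_n(γ) [sc_g - γ Δ_g W + β_n(γ) Γ(W)]` for the weighted manifold `X`. -/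
def invariantFormula (n γ : ℝ) (X : WeightedStructure d M) (x : M) : ℝ :=
  theta d n γ * (scalarCurvature X.metric x - γ * laplacian X.metric X.weight x +
    beta d n γ * gradInner X.metric X.weight X.weight x)

open Classical in
/-- `S_γ` as a function of the pair `(μ, Γ)`: the value `θ_n(γ) [sc_g - γ Δ_g W + β_n(γ) Γ(W)]` for
the metric `g` and the weight `W` with `Γ(f) = |∇f|²` and `dμ = e^{-W} dV_g`
(and `0` for pairs that do not come from a weighted manifold). -/
def SGamma (n γ : ℝ) (T : MeasureCarre d M) : M → ℝ :=
  if h : ∃ X : WeightedStructure d M, X.toPair = T then invariantFormula n γ h.choose else 0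

end Weighted

end

end WeightedManifold

/-! Put `c = e^τ`. The pair `(c^{-n} μ, c² Γ)` comes from the metric `e^{-2τ} g` and the weight `W +
(n-d) τ`, because `dV` scales by `e^{-dτ}`. Invariance is thus a statement about one conformal
change, and it rests on three classical formulas, whose right sides all carry the factor `e^{2τ}`:
`Γ' = e^{2τ} Γ`, `Δ' f = e^{2τ} (Δ f - (d-2) Γ(τ, f))`, `sc' = e^{2τ} (sc + 2(d-1) Δτ - (d-1)(d-2)
Γ(τ))`. They are proved in coordinates (`localGradInner_expScale`, `localLaplacian_expScale`,
`localScalarCurvature_expScale`) from the explicit difference of the two Levi-Civita connections.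
Inserting them in the formula for `S_γ`, the constants `β` and `θ` are exactly those that make the
extra terms a multiple of `Lτ - (n-2)/2 Γ(τ)`, with factor `(n-2)/2` (`invariantFormula_conformal`).

The formula depends on the pair alone because the pair determines `(g, W)` (`toPair_injective`).
Smooth functions have arbitrary differentials at a point, so `Γ` gives the inverse metric; `V_g` is
σ-finite and positive on open sets, so two continuous densities of `μ` coincide. -/

namespace WeightedManifold

/-! ### Calculus of partial derivatives. -/

section PartialDerivatives

variable {d : ℕ} {k : Fin d} {F H : EuclideanSpace ℝ (Fin d) → ℝ} {y : EuclideanSpace ℝ (Fin d)}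

theorem pderiv_add (hF : DifferentiableAt ℝ F y) (hH : DifferentiableAt ℝ H y) :
    pderiv k (fun z ↦ F z + H z) y = pderiv k F y + pderiv k H y := by
  simp [pderiv, fderiv_fun_add hF hH]

theorem pderiv_sub (hF : DifferentiableAt ℝ F y) (hH : DifferentiableAt ℝ H y) :
    pderiv k (fun z ↦ F z - H z) y = pderiv k F y - pderiv k H y := by
  simp [pderiv, fderiv_fun_sub hF hH]

theorem pderiv_mul (hF : DifferentiableAt ℝ F y) (hH : DifferentiableAt ℝ H y) :
    pderiv k (fun z ↦ F z * H z) y = pderiv k F y * H y + F y * pderiv k H y := by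
  simp [pderiv, fderiv_fun_mul hF hH]
  ring

theorem pderiv_const_mul (a : ℝ) (hF : DifferentiableAt ℝ F y) :
    pderiv k (fun z ↦ a * F z) y = a * pderiv k F y := by
  simp [pderiv, fderiv_const_mul hF]

theorem pderiv_sum {ι : Type*} (s : Finset ι) {F : ι → EuclideanSpace ℝ (Fin d) → ℝ}
    (hF : ∀ i, DifferentiableAt ℝ (F i) y) :
    pderiv k (fun z ↦ ∑ i ∈ s, F i z) y = ∑ i ∈ s, pderiv k (F i) y := by
  simp [pderiv, fderiv_fun_sum fun i _ ↦ hF i]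

theorem pderiv_exp (hF : DifferentiableAt ℝ F y) :
    pderiv k (fun z ↦ Real.exp (-2 * F z)) y = Real.exp (-2 * F y) * (-2 * pderiv k F y) := by
  have h := (hF.const_mul (-2)).hasFDerivAt.exp
  rw [pderiv, h.fderiv, fderiv_const_mul hF]
  simp [pderiv]

theorem pderiv_congr (h : F =ᶠ[nhds y] H) : pderiv k F y = pderiv k H y := by
  rw [pderiv, pderiv, h.fderiv_eq]

variable {U : Set (EuclideanSpace ℝ (Fin d))}

theorem _root_.ContDiffOn.pderiv (hU : IsOpen U) (hF : ContDiffOn ℝ ∞ F U) (k : Fin d) :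
    ContDiffOn ℝ ∞ (WeightedManifold.pderiv k F) U :=
  (hF.fderiv_of_isOpen hU (by simp)).clm_apply contDiffOn_const

theorem pderiv_comm (hU : IsOpen U) (hF : ContDiffOn ℝ ∞ F U) (hy : y ∈ U) (i j : Fin d) :
    pderiv i (pderiv j F) y = pderiv j (pderiv i F) y := by
  have hc : ContDiffAt ℝ ∞ F y := hF.contDiffAt (hU.mem_nhds hy)
  have hs := (hc.isSymmSndFDerivAt (by
    rw [minSmoothness_of_isRCLikeNormedField]
    exact WithTop.coe_le_coe.2 le_top)) (EuclideanSpace.single i 1) (EuclideanSpace.single j 1)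
  have hd : DifferentiableAt ℝ (fderiv ℝ F) y :=
    (hc.fderiv_right (m := 1) (by norm_cast)).differentiableAt (by simp)
  have key : ∀ a b : Fin d, pderiv a (pderiv b F) y =
      fderiv ℝ (fderiv ℝ F) y (EuclideanSpace.single a 1) (EuclideanSpace.single b 1) := by
    intro a b
    have : HasFDerivAt (pderiv b F) _ y :=
      hd.hasFDerivAt.clm_apply (hasFDerivAt_const (EuclideanSpace.single b (1 : ℝ)) y)
    rw [pderiv, this.fderiv]
    simp
  rw [key, key, hs]

end PartialDerivatives

/-! ### Local metrics and their Christoffel symbols. -/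

/-- A smooth field of invertible symmetric matrices on a set `U`. -/
structure IsLocalMetricOn {d : ℕ} (G : EuclideanSpace ℝ (Fin d) → Matrix (Fin d) (Fin d) ℝ)
    (U : Set (EuclideanSpace ℝ (Fin d))) : Prop where
  contDiffOn : ∀ i j, ContDiffOn ℝ ∞ (fun y ↦ G y i j) U
  symm : ∀ y ∈ U, ∀ i j, G y i j = G y j i
  isUnit : ∀ y ∈ U, IsUnit (G y).det

theorem contDiffOn_det {d : ℕ} {ι : Type*} [Fintype ι] [DecidableEq ι]
    {G : EuclideanSpace ℝ (Fin d) → Matrix ι ι ℝ}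
    {U : Set (EuclideanSpace ℝ (Fin d))} (h : ∀ i j, ContDiffOn ℝ ∞ (fun y ↦ G y i j) U) :
    ContDiffOn ℝ ∞ (fun y ↦ (G y).det) U := by
  simp only [Matrix.det_apply]
  refine ContDiffOn.sum fun σ _ ↦ ContDiffOn.const_smul _ ?_
  exact contDiffOn_prod fun i _ ↦ h _ _

namespace IsLocalMetricOn

variable {d : ℕ} {G : EuclideanSpace ℝ (Fin d) → Matrix (Fin d) (Fin d) ℝ}
  {U : Set (EuclideanSpace ℝ (Fin d))} {F H : EuclideanSpace ℝ (Fin d) → ℝ}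
  {y : EuclideanSpace ℝ (Fin d)}

/-- Cramer's rule: the entries of the adjugate are themselves determinants, and `det G` does not
vanish on `U`. -/
theorem contDiffOn_inv (hG : IsLocalMetricOn G U) (i j : Fin d) :
    ContDiffOn ℝ ∞ (fun y ↦ (G y)⁻¹ i j) U := by
  have h1 : ContDiffOn ℝ ∞ (fun y ↦ (G y).adjugate i j) U := by
    simp only [Matrix.adjugate_apply]
    refine contDiffOn_det fun a b ↦ ?_
    simp only [Matrix.updateRow_apply]
    split_ifs
    · exact contDiffOn_const
    · exact hG.contDiffOn a b
  refine (((contDiffOn_det hG.contDiffOn).inv fun y hy ↦ (hG.isUnit y hy).ne_zero).mul h1).congr ?_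
  intro y _
  simp [Matrix.inv_def]

theorem inv_symm (hG : IsLocalMetricOn G U) (hy : y ∈ U) (i j : Fin d) :
    (G y)⁻¹ i j = (G y)⁻¹ j i := by
  have h : (G y).transpose = G y := by
    ext a b
    exact hG.symm y hy b a
  conv_lhs => rw [← h, ← Matrix.transpose_nonsing_inv, Matrix.transpose_apply]

theorem sum_inv_mul (hG : IsLocalMetricOn G U) (hy : y ∈ U) (i j : Fin d) :
    ∑ l, (G y)⁻¹ i l * G y l j = if i = j then 1 else 0 := by
  rw [← Matrix.mul_apply, Matrix.nonsing_inv_mul _ (hG.isUnit y hy), Matrix.one_apply]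

theorem sum_mul_inv (hG : IsLocalMetricOn G U) (hy : y ∈ U) (i j : Fin d) :
    ∑ l, G y i l * (G y)⁻¹ l j = if i = j then 1 else 0 := by
  rw [← Matrix.mul_apply, Matrix.mul_nonsing_inv _ (hG.isUnit y hy), Matrix.one_apply]

theorem christoffel_symm (hG : IsLocalMetricOn G U) (hU : IsOpen U) (hy : y ∈ U) (k i j : Fin d) :
    christoffel G k i j y = christoffel G k j i y := by
  unfold christoffel
  congr 1
  refine Finset.sum_congr rfl fun l _ ↦ ?_
  have : pderiv l (fun z ↦ G z i j) y = pderiv l (fun z ↦ G z j i) y :=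
    pderiv_congr (Filter.eventuallyEq_of_mem (hU.mem_nhds hy) fun z hz ↦ hG.symm z hz i j)
  rw [this]
  ring

theorem contDiffOn_christoffel (hG : IsLocalMetricOn G U) (hU : IsOpen U) (k i j : Fin d) :
    ContDiffOn ℝ ∞ (christoffel G k i j) U := by
  unfold christoffel
  refine contDiffOn_const.mul (ContDiffOn.sum fun l _ ↦ (hG.contDiffOn_inv k l).mul ?_)
  exact (((hG.contDiffOn j l).pderiv hU i).add ((hG.contDiffOn i l).pderiv hU j)).sub
    ((hG.contDiffOn i j).pderiv hU l)

/-- Lowering the upper index of the Christoffel symbols. -/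
theorem sum_mul_christoffel (hG : IsLocalMetricOn G U) (hy : y ∈ U) (m i j : Fin d) :
    ∑ k, G y m k * christoffel G k i j y = (1 / 2 : ℝ) *
      (pderiv i (fun z ↦ G z j m) y + pderiv j (fun z ↦ G z i m) y
        - pderiv m (fun z ↦ G z i j) y) := by
  set B : Fin d → ℝ := fun l ↦ pderiv i (fun z ↦ G z j l) y + pderiv j (fun z ↦ G z i l) y
        - pderiv l (fun z ↦ G z i j) y with hB
  have : ∀ k, G y m k * christoffel G k i j y =
      ∑ l, (1 / 2 : ℝ) * (G y m k * (G y)⁻¹ k l * B l) := by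
    intro k
    simp only [christoffel, Finset.mul_sum, hB]
    exact Finset.sum_congr rfl fun l _ ↦ by ring
  simp only [this]
  rw [Finset.sum_comm]
  simp only [← Finset.mul_sum, ← Finset.sum_mul, hG.sum_mul_inv hy]
  simp [hB]

/-- The Levi-Civita connection preserves the metric. -/
theorem pderiv_eq_sum_christoffel (hG : IsLocalMetricOn G U) (hU : IsOpen U) (hy : y ∈ U)
    (k i j : Fin d) :
    pderiv k (fun z ↦ G z i j) y =
      ∑ l, (G y i l * christoffel G l k j y + G y j l * christoffel G l k i y) := by
  have hs : ∀ a b c, pderiv a (fun z ↦ G z b c) y = pderiv a (fun z ↦ G z c b) y := fun a b c ↦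
    pderiv_congr (Filter.eventuallyEq_of_mem (hU.mem_nhds hy) fun z hz ↦ hG.symm z hz b c)
  rw [Finset.sum_add_distrib, hG.sum_mul_christoffel hy, hG.sum_mul_christoffel hy,
    hs k j i, hs i k j]
  ring

end IsLocalMetricOn

/-! ### Conformal change of the connection and of the Laplacian. -/

noncomputable section

/-- The components `∑_l G^{kl} ∂_l F` of the gradient. -/
def localGrad {d : ℕ} (G : EuclideanSpace ℝ (Fin d) → Matrix (Fin d) (Fin d) ℝ)
    (F : EuclideanSpace ℝ (Fin d) → ℝ) (k : Fin d) (y : EuclideanSpace ℝ (Fin d)) : ℝ :=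
  ∑ l, (G y)⁻¹ k l * pderiv l F y

/-- The metric `e^{-2F} G`. -/
def expScale {d : ℕ} (G : EuclideanSpace ℝ (Fin d) → Matrix (Fin d) (Fin d) ℝ)
    (F : EuclideanSpace ℝ (Fin d) → ℝ) (y : EuclideanSpace ℝ (Fin d)) :
    Matrix (Fin d) (Fin d) ℝ :=
  Real.exp (-2 * F y) • G y

/-- The difference of the Christoffel symbols of `e^{-2F} G` and of `G`. -/
def christoffelDiff {d : ℕ} (G : EuclideanSpace ℝ (Fin d) → Matrix (Fin d) (Fin d) ℝ)
    (F : EuclideanSpace ℝ (Fin d) → ℝ) (k i j : Fin d) (y : EuclideanSpace ℝ (Fin d)) : ℝ :=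
  G y i j * localGrad G F k y -
    ((if k = j then 1 else 0) * pderiv i F y + (if k = i then 1 else 0) * pderiv j F y)

end

namespace IsLocalMetricOn

variable {d : ℕ} {G : EuclideanSpace ℝ (Fin d) → Matrix (Fin d) (Fin d) ℝ}
  {U : Set (EuclideanSpace ℝ (Fin d))} {F H K : EuclideanSpace ℝ (Fin d) → ℝ}
  {y : EuclideanSpace ℝ (Fin d)}

theorem contDiffOn_localGrad (hG : IsLocalMetricOn G U) (hU : IsOpen U) (hF : ContDiffOn ℝ ∞ F U)
    (k : Fin d) : ContDiffOn ℝ ∞ (localGrad G F k) U :=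
  ContDiffOn.sum fun l _ ↦ (hG.contDiffOn_inv k l).mul (hF.pderiv hU l)

theorem sum_mul_localGrad (hG : IsLocalMetricOn G U) (hy : y ∈ U) (i : Fin d) :
    ∑ k, G y i k * localGrad G F k y = pderiv i F y := by
  simp only [localGrad, Finset.mul_sum]
  rw [Finset.sum_comm]
  simp only [← mul_assoc, ← Finset.sum_mul, hG.sum_mul_inv hy]
  simp

theorem expScale_inv (hG : IsLocalMetricOn G U) (hy : y ∈ U) :
    (expScale G F y)⁻¹ = Real.exp (2 * F y) • (G y)⁻¹ := by
  refine Matrix.inv_eq_left_inv ?_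
  rw [expScale, Matrix.smul_mul, Matrix.mul_smul, Matrix.nonsing_inv_mul _ (hG.isUnit y hy),
    smul_smul, ← Real.exp_add]
  simp

/-- Since `∂(e^{-2F} G) = e^{-2F} (∂G - 2 ∂F G)`, the exponential cancels against that of the
inverse matrix. In the extra terms `G⁻¹ G` contracts to Kronecker deltas, or `G⁻¹ ∂F` to the
gradient. -/
theorem christoffel_expScale (hG : IsLocalMetricOn G U) (hU : IsOpen U) (hF : ContDiffOn ℝ ∞ F U)
    (hy : y ∈ U) (k i j : Fin d) :
    christoffel (expScale G F) k i j y = christoffel G k i j y + christoffelDiff G F k i j y := by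
  have hFd : DifferentiableAt ℝ F y :=
    (hF.contDiffAt (hU.mem_nhds hy)).differentiableAt (by simp)
  have hd : ∀ a b c, pderiv a (fun z ↦ expScale G F z b c) y =
      Real.exp (-2 * F y) * (pderiv a (fun z ↦ G z b c) y - 2 * pderiv a F y * G y b c) := by
    intro a b c
    have h1 : DifferentiableAt ℝ (fun z ↦ Real.exp (-2 * F z)) y := (hFd.const_mul _).exp
    have h2 : DifferentiableAt ℝ (fun z ↦ G z b c) y :=
      ((hG.contDiffOn b c).contDiffAt (hU.mem_nhds hy)).differentiableAt (by simp)
    have := pderiv_mul (k := a) h1 h2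
    simp only [expScale, Matrix.smul_apply, smul_eq_mul]
    rw [this, pderiv_exp hFd]
    ring
  have he : Real.exp (2 * F y) * Real.exp (-2 * F y) = 1 := by
    rw [← Real.exp_add]; simp
  have hterm : ∀ l, (expScale G F y)⁻¹ k l * (pderiv i (fun z ↦ expScale G F z j l) y +
      pderiv j (fun z ↦ expScale G F z i l) y - pderiv l (fun z ↦ expScale G F z i j) y) =
      (G y)⁻¹ k l * (pderiv i (fun z ↦ G z j l) y + pderiv j (fun z ↦ G z i l) y
        - pderiv l (fun z ↦ G z i j) y)
      - 2 * (((G y)⁻¹ k l * G y l j) * pderiv i F y + ((G y)⁻¹ k l * G y l i) * pderiv j F y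
        - G y i j * ((G y)⁻¹ k l * pderiv l F y)) := by
    intro l
    rw [hG.expScale_inv hy, hd, hd, hd, hG.symm y hy l j, hG.symm y hy l i]
    simp only [Matrix.smul_apply, smul_eq_mul]
    linear_combination ((G y)⁻¹ k l * (pderiv i (fun z ↦ G z j l) y + pderiv j (fun z ↦ G z i l) y
        - pderiv l (fun z ↦ G z i j) y - 2 * (G y j l * pderiv i F y + G y i l * pderiv j F y -
        G y i j * pderiv l F y))) * he
  unfold christoffel christoffelDiff localGrad
  rw [Finset.sum_congr rfl fun l _ ↦ hterm l]
  simp only [Finset.sum_sub_distrib, Finset.sum_add_distrib, ← Finset.mul_sum, ← Finset.sum_mul,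
    hG.sum_inv_mul hy]
  ring

theorem contDiffOn_christoffelDiff (hG : IsLocalMetricOn G U) (hU : IsOpen U)
    (hF : ContDiffOn ℝ ∞ F U) (k i j : Fin d) : ContDiffOn ℝ ∞ (christoffelDiff G F k i j) U :=
  ((hG.contDiffOn i j).mul (hG.contDiffOn_localGrad hU hF k)).sub
    ((contDiffOn_const.mul (hF.pderiv hU i)).add (contDiffOn_const.mul (hF.pderiv hU j)))

/-- The gradient term contributes `∂_i F`, the two delta terms `-d ∂_i F` and `-∂_i F`. -/
theorem sum_christoffelDiff (hG : IsLocalMetricOn G U) (hy : y ∈ U) (i : Fin d) :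
    ∑ k, christoffelDiff G F k i k y = -d * pderiv i F y := by
  simp only [christoffelDiff, Finset.sum_sub_distrib, Finset.sum_add_distrib,
    hG.sum_mul_localGrad hy]
  simp

theorem sum_christoffelDiff' (hG : IsLocalMetricOn G U) (hy : y ∈ U) (i : Fin d) :
    ∑ k, christoffelDiff G F k k i y = -d * pderiv i F y := by
  rw [← hG.sum_christoffelDiff hy]
  refine Finset.sum_congr rfl fun k _ ↦ ?_
  simp only [christoffelDiff, hG.symm y hy k i]
  ring

/-- The divergence of the gradient is the Laplacian. -/
theorem sum_pderiv_localGrad (hG : IsLocalMetricOn G U) (hU : IsOpen U) (hF : ContDiffOn ℝ ∞ F U)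
    (hy : y ∈ U) :
    ∑ k, pderiv k (localGrad G F k) y =
      localLaplacian G F y - ∑ k, ∑ l, christoffel G k k l y * localGrad G F l y := by
  have hG' : ∀ i k, DifferentiableAt ℝ (fun z ↦ G z i k) y := fun i k ↦
    ((hG.contDiffOn i k).contDiffAt (hU.mem_nhds hy)).differentiableAt (by simp)
  have hv : ∀ k, DifferentiableAt ℝ (localGrad G F k) y := fun k ↦
    ((hG.contDiffOn_localGrad hU hF k).contDiffAt (hU.mem_nhds hy)).differentiableAt (by simp)
  -- Differentiating `∂_i F = ∑_k G_ik (grad F)^k` avoids any derivative of the inverse matrix.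
  have h1 : ∀ i j, pderiv j (pderiv i F) y = ∑ k, (pderiv j (fun z ↦ G z i k) y * localGrad G F k y
      + G y i k * pderiv j (localGrad G F k) y) := by
    intro i j
    have : pderiv i F =ᶠ[nhds y] fun z ↦ ∑ k, G z i k * localGrad G F k z :=
      Filter.eventuallyEq_of_mem (hU.mem_nhds hy) fun z hz ↦ (hG.sum_mul_localGrad hz i).symm
    rw [pderiv_congr this, pderiv_sum (F := fun k z ↦ G z i k * localGrad G F k z) _
      fun k ↦ (hG' i k).mul (hv k)]
    exact Finset.sum_congr rfl fun k _ ↦ pderiv_mul (hG' i k) (hv k)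
  have h2 : ∑ j, ∑ i, (G y)⁻¹ j i * pderiv j (pderiv i F) y =
      ∑ j, ∑ k, (∑ i, (G y)⁻¹ j i * pderiv j (fun z ↦ G z i k) y) * localGrad G F k y +
        ∑ k, pderiv k (localGrad G F k) y := by
    rw [← Finset.sum_add_distrib]
    refine Finset.sum_congr rfl fun j _ ↦ ?_
    simp only [h1, Finset.mul_sum, Finset.sum_mul]
    rw [Finset.sum_comm]
    simp only [mul_add, Finset.sum_add_distrib]
    congr 1
    · exact Finset.sum_congr rfl fun k _ ↦ Finset.sum_congr rfl fun i _ ↦ by ring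
    · simp only [← mul_assoc, ← Finset.sum_mul, hG.sum_inv_mul hy]
      simp
  -- Metric compatibility. The first term is the connection part of the divergence; the second,
  -- paired with the gradient, is the Christoffel part of the Hessian trace (`h4`).
  have h3 : ∀ j k, ∑ i, (G y)⁻¹ j i * pderiv j (fun z ↦ G z i k) y =
      christoffel G j j k y + ∑ i, ∑ l, (G y)⁻¹ j i * (G y k l * christoffel G l j i y) := by
    intro j k
    simp only [hG.pderiv_eq_sum_christoffel hU hy, Finset.sum_add_distrib, mul_add, Finset.mul_sum]
    congr 1
    rw [Finset.sum_comm]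
    simp only [← mul_assoc, ← Finset.sum_mul, hG.sum_inv_mul hy]
    simp
  have h4 : ∑ j, ∑ k, (∑ i, ∑ l, (G y)⁻¹ j i * (G y k l * christoffel G l j i y)) *
      localGrad G F k y = ∑ j, ∑ i, (G y)⁻¹ j i * ∑ l, christoffel G l j i y * pderiv l F y := by
    refine Finset.sum_congr rfl fun j _ ↦ ?_
    simp only [Finset.sum_mul]
    rw [Finset.sum_comm]
    refine Finset.sum_congr rfl fun i _ ↦ ?_
    rw [Finset.sum_comm, Finset.mul_sum]
    refine Finset.sum_congr rfl fun l _ ↦ ?_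
    rw [← hG.sum_mul_localGrad hy l]
    simp only [Finset.mul_sum]
    refine Finset.sum_congr rfl fun k _ ↦ ?_
    rw [hG.symm y hy k l]
    ring
  simp only [localLaplacian, mul_sub, Finset.sum_sub_distrib]
  rw [h2, ← h4]
  simp only [h3, add_mul, Finset.sum_add_distrib]
  ring

theorem localGradInner_eq (F H : EuclideanSpace ℝ (Fin d) → ℝ) :
    localGradInner G H F y = ∑ k, pderiv k H y * localGrad G F k y := by
  simp only [localGradInner, localGrad, Finset.mul_sum]
  exact Finset.sum_congr rfl fun i _ ↦ Finset.sum_congr rfl fun j _ ↦ by ring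

theorem localGradInner_expScale (hG : IsLocalMetricOn G U) (hy : y ∈ U) :
    localGradInner (expScale G F) H K y = Real.exp (2 * F y) * localGradInner G H K y := by
  simp only [localGradInner, hG.expScale_inv hy, Matrix.smul_apply, smul_eq_mul, Finset.mul_sum,
    mul_assoc]

theorem sum_inv_mul_self (hG : IsLocalMetricOn G U) (hy : y ∈ U) :
    ∑ i, ∑ j, (G y)⁻¹ i j * G y i j = d := by
  have : ∀ i, ∑ j, (G y)⁻¹ i j * G y i j = 1 := by
    intro i
    simp only [hG.symm y hy i]
    rw [hG.sum_inv_mul hy]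
    simp
  simp [this]

/-- The Hessian of `H` changes by minus the difference tensor applied to `dH`. In its trace `G_ij`
contributes `d` and the two delta terms `-2`, whence `d - 2`. -/
theorem localLaplacian_expScale (hG : IsLocalMetricOn G U) (hU : IsOpen U)
    (hF : ContDiffOn ℝ ∞ F U) (hy : y ∈ U) :
    localLaplacian (expScale G F) H y =
      Real.exp (2 * F y) * (localLaplacian G H y - (d - 2) * localGradInner G F H y) := by
  have h1 : ∀ i j, ∑ k, christoffelDiff G F k i j y * pderiv k H y =
      G y i j * localGradInner G H F y - (pderiv i F y * pderiv j H y + pderiv j F y * pderiv i H y)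
      := by
    intro i j
    rw [localGradInner_eq]
    simp only [christoffelDiff, sub_mul, add_mul, Finset.sum_sub_distrib, Finset.sum_add_distrib,
      Finset.mul_sum]
    congr 1
    · exact Finset.sum_congr rfl fun k _ ↦ by ring
    · simp
  have hsymm : localGradInner G H F y = localGradInner G F H y := by
    simp only [localGradInner]
    rw [Finset.sum_comm]
    refine Finset.sum_congr rfl fun i _ ↦ Finset.sum_congr rfl fun j _ ↦ ?_
    rw [hG.inv_symm hy i j]
    ring
  have h2 : ∑ i, ∑ j, (G y)⁻¹ i j * (pderiv j F y * pderiv i H y) = localGradInner G H F y := by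
    simp only [localGradInner]
    exact Finset.sum_congr rfl fun i _ ↦ Finset.sum_congr rfl fun j _ ↦ by ring
  have h3 : localLaplacian (expScale G F) H y = Real.exp (2 * F y) * (localLaplacian G H y -
      ∑ i, ∑ j, (G y)⁻¹ i j * ∑ k, christoffelDiff G F k i j y * pderiv k H y) := by
    simp only [localLaplacian, hG.expScale_inv hy, Matrix.smul_apply, smul_eq_mul]
    rw [← Finset.sum_sub_distrib, Finset.mul_sum]
    refine Finset.sum_congr rfl fun i _ ↦ ?_
    rw [← Finset.sum_sub_distrib, Finset.mul_sum]
    refine Finset.sum_congr rfl fun j _ ↦ ?_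
    simp only [hG.christoffel_expScale hU hF hy, add_mul, Finset.sum_add_distrib]
    ring
  rw [h3]
  simp only [h1, mul_sub, mul_add, Finset.sum_sub_distrib, Finset.sum_add_distrib, h2]
  simp only [← mul_assoc, ← Finset.sum_mul, hG.sum_inv_mul_self hy]
  simp only [mul_assoc]
  rw [show ∑ i, ∑ j, (G y)⁻¹ i j * (pderiv i F y * pderiv j H y) = localGradInner G F H y from rfl,
    hsymm]
  ring

end IsLocalMetricOn
end WeightedManifold

/-! ### Conformal change of the curvature. -/

namespace WeightedManifold
namespace IsLocalMetricOn

variable {d : ℕ} {G : EuclideanSpace ℝ (Fin d) → Matrix (Fin d) (Fin d) ℝ}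
  {U : Set (EuclideanSpace ℝ (Fin d))} {F : EuclideanSpace ℝ (Fin d) → ℝ}
  {y : EuclideanSpace ℝ (Fin d)}

/-- The sum with `∂_k G_ij` is not tensorial; it cancels in the Ricci tensor against the last sum of
`sum_christoffel_mul_christoffelDiff`. -/
theorem sum_pderiv_christoffelDiff (hG : IsLocalMetricOn G U) (hU : IsOpen U)
    (hF : ContDiffOn ℝ ∞ F U) (hy : y ∈ U) (i j : Fin d) :
    ∑ k, pderiv k (christoffelDiff G F k i j) y =
      ∑ k, pderiv k (fun z ↦ G z i j) y * localGrad G F k y +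
        G y i j * ∑ k, pderiv k (localGrad G F k) y - 2 * pderiv i (pderiv j F) y := by
  have hd : ∀ {f : EuclideanSpace ℝ (Fin d) → ℝ}, ContDiffOn ℝ ∞ f U → DifferentiableAt ℝ f y :=
    fun hf ↦ (hf.contDiffAt (hU.mem_nhds hy)).differentiableAt (by simp)
  have h : ∀ k, pderiv k (christoffelDiff G F k i j) y =
      pderiv k (fun z ↦ G z i j) y * localGrad G F k y + G y i j * pderiv k (localGrad G F k) y
      - ((if k = j then 1 else 0) * pderiv k (pderiv i F) y +
        (if k = i then 1 else 0) * pderiv k (pderiv j F) y) := by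
    intro k
    have e1 := hd (hG.contDiffOn i j)
    have e2 := hd (hG.contDiffOn_localGrad hU hF k)
    have e3 := hd (hF.pderiv hU i)
    have e4 := hd (hF.pderiv hU j)
    have e5 : pderiv k (christoffelDiff G F k i j) y =
        pderiv k (fun z ↦ G z i j * localGrad G F k z) y -
        pderiv k (fun z ↦ (if k = j then 1 else 0) * pderiv i F z +
          (if k = i then 1 else 0) * pderiv j F z) y :=
      pderiv_sub (e1.mul e2) ((e3.const_mul _).add (e4.const_mul _))
    rw [e5, pderiv_mul e1 e2, pderiv_add (e3.const_mul _) (e4.const_mul _),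
      pderiv_const_mul _ e3, pderiv_const_mul _ e4]
  simp only [h, Finset.sum_sub_distrib, Finset.sum_add_distrib, ite_mul, one_mul, zero_mul,
    Finset.sum_ite_eq', Finset.mem_univ, if_true, Finset.mul_sum]
  rw [pderiv_comm hU hF hy j i]
  ring

theorem sum_pderiv_christoffelDiff' (hG : IsLocalMetricOn G U) (hU : IsOpen U)
    (hF : ContDiffOn ℝ ∞ F U) (hy : y ∈ U) (i j : Fin d) :
    ∑ k, pderiv j (christoffelDiff G F k i k) y = -d * pderiv i (pderiv j F) y := by
  have hd : ∀ {f : EuclideanSpace ℝ (Fin d) → ℝ}, ContDiffOn ℝ ∞ f U → DifferentiableAt ℝ f y :=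
    fun hf ↦ (hf.contDiffAt (hU.mem_nhds hy)).differentiableAt (by simp)
  rw [← pderiv_sum (F := fun k ↦ christoffelDiff G F k i k) _
    fun k ↦ hd (hG.contDiffOn_christoffelDiff hU hF k i k)]
  rw [pderiv_congr (H := fun z ↦ -d * pderiv i F z)
    (Filter.eventuallyEq_of_mem (hU.mem_nhds hy) fun z hz ↦ hG.sum_christoffelDiff hz i),
    pderiv_const_mul _ (hd (hF.pderiv hU i)), pderiv_comm hU hF hy]

/-- The terms of the Ricci curvature that are linear in the difference of the connections. -/
theorem sum_christoffel_mul_christoffelDiff (hG : IsLocalMetricOn G U) (hU : IsOpen U)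
    (hy : y ∈ U) (i j : Fin d) :
    ∑ k, ∑ l, (christoffelDiff G F k k l y * christoffel G l i j y
      + christoffel G k k l y * christoffelDiff G F l i j y
      - christoffelDiff G F k j l y * christoffel G l i k y
      - christoffel G k j l y * christoffelDiff G F l i k y) =
    (2 - d) * ∑ l, christoffel G l i j y * pderiv l F y
      + G y i j * ∑ k, ∑ l, christoffel G k k l y * localGrad G F l y
      - ∑ k, pderiv k (fun z ↦ G z i j) y * localGrad G F k y := by
  have h1 : ∑ k, ∑ l, christoffelDiff G F k k l y * christoffel G l i j y =
      -d * ∑ l, christoffel G l i j y * pderiv l F y := by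
    rw [Finset.sum_comm]
    simp only [← Finset.sum_mul, hG.sum_christoffelDiff' hy, Finset.mul_sum]
    exact Finset.sum_congr rfl fun k _ ↦ by ring
  have h2 : ∑ k, ∑ l, christoffel G k k l y * christoffelDiff G F l i j y =
      G y i j * ∑ k, ∑ l, christoffel G k k l y * localGrad G F l y
      - (∑ k, christoffel G k k j y) * pderiv i F y
      - (∑ k, christoffel G k k i y) * pderiv j F y := by
    rw [Finset.mul_sum, Finset.sum_mul, Finset.sum_mul, ← Finset.sum_sub_distrib,
      ← Finset.sum_sub_distrib]
    refine Finset.sum_congr rfl fun k _ ↦ ?_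
    simp only [christoffelDiff, mul_sub, mul_add, Finset.sum_sub_distrib, Finset.sum_add_distrib,
      ite_mul, mul_ite, one_mul, zero_mul, mul_zero, Finset.sum_ite_eq', Finset.mem_univ, if_true,
      Finset.mul_sum]
    simp only [mul_left_comm (christoffel G _ _ _ y)]
    ring
  have h3 : ∀ i j, ∑ k, ∑ l, christoffelDiff G F k j l y * christoffel G l i k y =
      ∑ k, ∑ l, G y j l * localGrad G F k y * christoffel G l i k y
      - (∑ k, christoffel G k k i y) * pderiv j F y
      - ∑ l, christoffel G l i j y * pderiv l F y := by
    intro i j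
    simp only [christoffelDiff, sub_mul, add_mul, Finset.sum_sub_distrib, Finset.sum_add_distrib,
      ite_mul, one_mul, zero_mul, Finset.sum_ite_eq, Finset.sum_ite_irrel, Finset.sum_const_zero,
      Finset.sum_ite_eq', Finset.mem_univ, if_true]
    rw [Finset.sum_mul, sub_sub]
    congr 2
    · exact Finset.sum_congr rfl fun k _ ↦ by rw [hG.christoffel_symm hU hy k i k]; ring
    · exact Finset.sum_congr rfl fun k _ ↦ by ring
  -- This is `h3` with `i` and `j` exchanged, after renaming the summation indices.
  have h4 : ∑ k, ∑ l, christoffel G k j l y * christoffelDiff G F l i k y =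
      ∑ k, ∑ l, G y i l * localGrad G F k y * christoffel G l j k y
      - (∑ k, christoffel G k k j y) * pderiv i F y
      - ∑ l, christoffel G l i j y * pderiv l F y := by
    simp only [hG.christoffel_symm hU hy _ i j]
    rw [← h3 j i, Finset.sum_comm]
    exact Finset.sum_congr rfl fun k _ ↦ Finset.sum_congr rfl fun l _ ↦ mul_comm _ _
  -- By metric compatibility the leading sums of `h3` and `h4` recombine into the derivative of
  -- `G_ij` along the gradient.
  have h5 : ∑ k, pderiv k (fun z ↦ G z i j) y * localGrad G F k y =
      ∑ k, ∑ l, G y j l * localGrad G F k y * christoffel G l i k y +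
      ∑ k, ∑ l, G y i l * localGrad G F k y * christoffel G l j k y := by
    rw [← Finset.sum_add_distrib]
    refine Finset.sum_congr rfl fun k _ ↦ ?_
    rw [hG.pderiv_eq_sum_christoffel hU hy, Finset.sum_mul, ← Finset.sum_add_distrib]
    refine Finset.sum_congr rfl fun l _ ↦ ?_
    rw [hG.christoffel_symm hU hy l k j, hG.christoffel_symm hU hy l k i]
    ring
  simp only [Finset.sum_sub_distrib, Finset.sum_add_distrib]
  rw [h1, h2, h3, h4, h5]
  ring

/-- The terms of the Ricci curvature that are quadratic in the difference of the connections. -/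
theorem sum_christoffelDiff_mul_christoffelDiff (hG : IsLocalMetricOn G U)
    (hy : y ∈ U) (i j : Fin d) :
    ∑ k, ∑ l, (christoffelDiff G F k k l y * christoffelDiff G F l i j y
      - christoffelDiff G F k j l y * christoffelDiff G F l i k y) =
    (d - 2) * (pderiv i F y * pderiv j F y - G y i j * localGradInner G F F y) := by
  have h1 : ∑ k, ∑ l, christoffelDiff G F k k l y * christoffelDiff G F l i j y =
      d * (2 * (pderiv i F y * pderiv j F y) - G y i j * localGradInner G F F y) := by
    rw [Finset.sum_comm]
    simp only [← Finset.sum_mul, hG.sum_christoffelDiff' hy, localGradInner_eq]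
    simp only [christoffelDiff, mul_sub, mul_add, Finset.sum_sub_distrib, Finset.sum_add_distrib,
      ite_mul, one_mul, zero_mul, mul_ite, mul_zero, Finset.sum_ite_eq', Finset.mem_univ, if_true,
      Finset.mul_sum, neg_mul, Finset.sum_neg_distrib]
    have : ∀ l, (d : ℝ) * (G y i j * (pderiv l F y * localGrad G F l y)) =
      d * pderiv l F y * (G y i j * localGrad G F l y) := fun l ↦ by ring
    simp only [this]
    ring
  have h2 : ∑ k, ∑ l, christoffelDiff G F k j l y * christoffelDiff G F l i k y =
      (d + 2) * (pderiv i F y * pderiv j F y) - 2 * (G y i j * localGradInner G F F y) := by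
    -- The covector `w` is left free because both the row `G_j·` and the differential of `F` are
    -- needed.
    have e1 : ∀ (w : Fin d → ℝ) (k : Fin d), ∑ l, w l * christoffelDiff G F l i k y =
        G y i k * ∑ l, w l * localGrad G F l y - (w k * pderiv i F y + w i * pderiv k F y) := by
      intro w k
      simp only [christoffelDiff, mul_sub, mul_add, Finset.sum_sub_distrib,
        Finset.sum_add_distrib, ite_mul, one_mul, zero_mul, mul_ite, mul_zero, Finset.sum_ite_eq',
        Finset.mem_univ, if_true, Finset.mul_sum]
      simp only [mul_left_comm (w _)]
    have e2 : ∀ k, ∑ l, christoffelDiff G F k j l y * christoffelDiff G F l i k y =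
        localGrad G F k y * ∑ l, G y j l * christoffelDiff G F l i k y
        - pderiv j F y * christoffelDiff G F k i k y
        - (if k = j then ∑ l, pderiv l F y * christoffelDiff G F l i k y else 0) := by
      intro k
      have : ∀ l, christoffelDiff G F k j l y * christoffelDiff G F l i k y =
          localGrad G F k y * (G y j l * christoffelDiff G F l i k y)
          - (if k = l then pderiv j F y * christoffelDiff G F l i k y else 0)
          - (if k = j then pderiv l F y * christoffelDiff G F l i k y else 0) := by
        intro l
        conv_lhs => rw [christoffelDiff]
        split_ifs <;> ring
      simp only [this, Finset.sum_sub_distrib, Finset.sum_ite_eq, Finset.mem_univ, if_true,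
        Finset.mul_sum, Finset.sum_ite_irrel, Finset.sum_const_zero]
    have e3 : ∀ k, localGrad G F k y * (G y i k * pderiv j F y
        - (G y j k * pderiv i F y + G y j i * pderiv k F y)) =
        pderiv j F y * (G y i k * localGrad G F k y) - pderiv i F y * (G y j k * localGrad G F k y)
        - G y j i * (pderiv k F y * localGrad G F k y) := fun k ↦ by ring
    simp only [e2, e1, hG.sum_mul_localGrad hy, ← localGradInner_eq, e3, Finset.sum_sub_distrib,
      ← Finset.mul_sum, hG.sum_christoffelDiff hy, Finset.sum_ite_eq', Finset.mem_univ, if_true]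
    rw [hG.symm y hy j i]
    ring
  simp only [Finset.sum_sub_distrib]
  rw [h1, h2]
  ring

/-- Ricci curvature is quadratic in the connection, so adding the difference tensor `C` produces
derivatives of `C`, cross terms and terms in `C * C`. The cross terms turn the partial derivatives
into covariant ones: second derivatives of `F` become its Hessian, and the divergence of the
gradient becomes the Laplacian. -/
theorem ricci_expScale (hG : IsLocalMetricOn G U) (hU : IsOpen U)
    (hF : ContDiffOn ℝ ∞ F U) (hy : y ∈ U) (i j : Fin d) :
    ricci (expScale G F) i j y = ricci G i j y +
      (d - 2) * (pderiv i (pderiv j F) y - ∑ k, christoffel G k i j y * pderiv k F y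
        + pderiv i F y * pderiv j F y) +
      G y i j * (localLaplacian G F y - (d - 2) * localGradInner G F F y) := by
  have hd : ∀ {f : EuclideanSpace ℝ (Fin d) → ℝ}, ContDiffOn ℝ ∞ f U → DifferentiableAt ℝ f y :=
    fun hf ↦ (hf.contDiffAt (hU.mem_nhds hy)).differentiableAt (by simp)
  have h1 : ∀ a k i j, pderiv a (christoffel (expScale G F) k i j) y =
      pderiv a (christoffel G k i j) y + pderiv a (christoffelDiff G F k i j) y := by
    intro a k i j
    rw [← pderiv_add (hd (hG.contDiffOn_christoffel hU k i j))
      (hd (hG.contDiffOn_christoffelDiff hU hF k i j))]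
    exact pderiv_congr (Filter.eventuallyEq_of_mem (hU.mem_nhds hy) fun z hz ↦
      hG.christoffel_expScale hU hF hz k i j)
  have h2 := hG.sum_christoffel_mul_christoffelDiff (F := F) hU hy i j
  have h3 := hG.sum_christoffelDiff_mul_christoffelDiff (F := F) hy i j
  have h4 := hG.sum_pderiv_christoffelDiff hU hF hy i j
  have h5 := hG.sum_pderiv_christoffelDiff' hU hF hy i j
  have h6 := hG.sum_pderiv_localGrad hU hF hy
  simp only [ricci, h1, hG.christoffel_expScale hU hF hy, add_mul, mul_add, Finset.sum_sub_distrib,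
    Finset.sum_add_distrib] at h2 h3 ⊢
  rw [h4, h5, h6]
  linear_combination h2 + h3

/-- Trace of `ricci_expScale`, using `(d-2) + d = 2(d-1)` and `(d-2) - d(d-2) = -(d-1)(d-2)`. -/
theorem localScalarCurvature_expScale (hG : IsLocalMetricOn G U) (hU : IsOpen U)
    (hF : ContDiffOn ℝ ∞ F U) (hy : y ∈ U) :
    localScalarCurvature (expScale G F) y = Real.exp (2 * F y) * (localScalarCurvature G y +
      2 * (d - 1) * localLaplacian G F y - (d - 1) * (d - 2) * localGradInner G F F y) := by
  have h1 : localScalarCurvature (expScale G F) y = Real.exp (2 * F y) * (localScalarCurvature G y +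
      (d - 2) * (localLaplacian G F y + localGradInner G F F y) +
      (∑ i, ∑ j, (G y)⁻¹ i j * G y i j) *
        (localLaplacian G F y - (d - 2) * localGradInner G F F y)) := by
    have hr := hG.ricci_expScale hU hF hy
    have hL : localLaplacian G F y = ∑ i, ∑ j, (G y)⁻¹ i j *
      (pderiv i (pderiv j F) y - ∑ k, christoffel G k i j y * pderiv k F y) := rfl
    have hI : localGradInner G F F y = ∑ i, ∑ j, (G y)⁻¹ i j * (pderiv i F y * pderiv j F y) := rfl
    have hS : localScalarCurvature G y = ∑ i, ∑ j, (G y)⁻¹ i j * ricci G i j y := rfl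
    -- The factor of `G_ij` does not depend on `i, j` and must stay closed while the other
    -- occurrences are expanded into sums.
    generalize localLaplacian G F y - (d - 2) * localGradInner G F F y = q at hr ⊢
    rw [hL, hI, hS, localScalarCurvature]
    simp only [Finset.mul_sum, Finset.sum_mul, ← Finset.sum_add_distrib]
    refine Finset.sum_congr rfl fun i _ ↦ Finset.sum_congr rfl fun j _ ↦ ?_
    rw [hr, hG.expScale_inv hy]
    simp only [Matrix.smul_apply, smul_eq_mul]
    ring
  rw [h1, hG.sum_inv_mul_self hy]
  ring

end IsLocalMetricOn
end WeightedManifold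

/-! ### From coordinates to the manifold. -/

namespace WeightedManifold

noncomputable section

variable {d : ℕ} {M : Type*} [TopologicalSpace M] [ChartedSpace (EuclideanSpace ℝ (Fin d)) M]
  [IsManifold (𝓡 d) ∞ M]

/-- The coordinate vector fields of the preferred chart at `x`. -/
def coordVec (x : M) (y : EuclideanSpace ℝ (Fin d)) (i : Fin d) :
    TangentSpace (𝓡 d) ((chartAt (EuclideanSpace ℝ (Fin d)) x).symm y) :=
  mfderiv 𝓘(ℝ, EuclideanSpace ℝ (Fin d)) (𝓡 d) (chartAt (EuclideanSpace ℝ (Fin d)) x).symm y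
    (EuclideanSpace.single i (1 : ℝ) : EuclideanSpace ℝ (Fin d))

theorem metricInChart_apply (g : SmoothMetric d M) (x : M) (y : EuclideanSpace ℝ (Fin d))
    (i j : Fin d) : metricInChart g x y i j =
      g.inner ((chartAt (EuclideanSpace ℝ (Fin d)) x).symm y) (coordVec x y i) (coordVec x y j) :=
  rfl

/-- The field is the tangent map of the smooth inverse chart composed with a constant section. -/
theorem contMDiffOn_coordVec (x : M) (i : Fin d) :
    ContMDiffOn 𝓘(ℝ, EuclideanSpace ℝ (Fin d)) (𝓡 d).tangent ∞
      (fun y ↦ (⟨(chartAt (EuclideanSpace ℝ (Fin d)) x).symm y, coordVec x y i⟩ :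
        TangentBundle (𝓡 d) M)) (chartAt (EuclideanSpace ℝ (Fin d)) x).target := by
  set φ := chartAt (EuclideanSpace ℝ (Fin d)) x
  have h1 : ContMDiffOn 𝓘(ℝ, EuclideanSpace ℝ (Fin d)) (𝓡 d) ∞ φ.symm φ.target :=
    contMDiffOn_chart_symm
  have h2 := h1.contMDiffOn_tangentMapWithin (m := ∞) le_rfl φ.open_target.uniqueMDiffOn
  have h3 := (contMDiffOn_vectorSpace_iff_contDiffOn (𝕜 := ℝ) (n := ∞) (s := φ.target)
    (V := fun _ : EuclideanSpace ℝ (Fin d) ↦ EuclideanSpace.single i (1 : ℝ))).2 contDiffOn_const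
  refine (h2.comp h3 fun y hy ↦ hy).congr fun y hy ↦ ?_
  simp only [Function.comp, tangentMapWithin, coordVec]
  rw [mfderivWithin_of_isOpen φ.open_target hy]

theorem contDiffOn_metricInChart (g : SmoothMetric d M) (x : M) (i j : Fin d) :
    ContDiffOn ℝ ∞ (fun y ↦ metricInChart g x y i j)
      (chartAt (EuclideanSpace ℝ (Fin d)) x).target := by
  set φ := chartAt (EuclideanSpace ℝ (Fin d)) x
  have h1 : ContMDiffOn 𝓘(ℝ, EuclideanSpace ℝ (Fin d)) (𝓡 d) ∞ φ.symm φ.target :=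
    contMDiffOn_chart_symm
  rw [← contMDiffOn_iff_contDiffOn]
  -- The function is viewed as a section of the trivial line bundle, so that the metric can be
  -- applied to two smooth fields bundle-wise.
  have h : ContMDiffOn 𝓘(ℝ, EuclideanSpace ℝ (Fin d)) ((𝓡 d).prod 𝓘(ℝ, ℝ)) ∞
      (fun y ↦ Bundle.TotalSpace.mk' ℝ (E := Bundle.Trivial M ℝ) (φ.symm y)
        (metricInChart g x y i j)) φ.target := by
    refine ContMDiffOn.clm_bundle_apply₂ (F₁ := EuclideanSpace ℝ (Fin d))
      (F₂ := EuclideanSpace ℝ (Fin d)) ?_ (contMDiffOn_coordVec x i) (contMDiffOn_coordVec x j)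
    exact g.contMDiff.comp_contMDiffOn h1
  intro y hy
  have := h y hy
  rw [Bundle.contMDiffWithinAt_totalSpace] at this
  exact this.2

theorem linearIndependent_coordVec (x : M) {y : EuclideanSpace ℝ (Fin d)}
    (hy : y ∈ (chartAt (EuclideanSpace ℝ (Fin d)) x).target) :
    LinearIndependent ℝ (coordVec x y) := by
  have h := ((mdifferentiable_chart (I := 𝓡 d) x).symm.mfderiv_injective hy)
  have hb := (EuclideanSpace.basisFun (Fin d) ℝ).toBasis.linearIndependent
  have := hb.map' (mfderiv 𝓘(ℝ, EuclideanSpace ℝ (Fin d)) (𝓡 d)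
    (chartAt (EuclideanSpace ℝ (Fin d)) x).symm y).toLinearMap (LinearMap.ker_eq_bot.2 h)
  have e : coordVec x y = mfderiv 𝓘(ℝ, EuclideanSpace ℝ (Fin d)) (𝓡 d)
      (chartAt (EuclideanSpace ℝ (Fin d)) x).symm y ∘
        (EuclideanSpace.basisFun (Fin d) ℝ).toBasis := by
    ext1 i
    have hi : (EuclideanSpace.single i (1 : ℝ) : EuclideanSpace ℝ (Fin d)) =
        (EuclideanSpace.basisFun (Fin d) ℝ).toBasis i := by simp
    exact congrArg (mfderiv 𝓘(ℝ, EuclideanSpace ℝ (Fin d)) (𝓡 d)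
      (chartAt (EuclideanSpace ℝ (Fin d)) x).symm y) hi
  rw [e]
  exact this

theorem posDef_metricInChart (g : SmoothMetric d M) (x : M) {y : EuclideanSpace ℝ (Fin d)}
    (hy : y ∈ (chartAt (EuclideanSpace ℝ (Fin d)) x).target) : (metricInChart g x y).PosDef := by
  refine Matrix.PosDef.of_dotProduct_mulVec_pos ?_ fun v hv ↦ ?_
  · ext i j
    simp [metricInChart_apply, g.symm _ (coordVec x y j)]
  · have h0 : ∑ i, v i • coordVec x y i ≠ 0 := by
      intro h
      exact hv (funext (Fintype.linearIndependent_iff.1 (linearIndependent_coordVec x hy) v h))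
    have := g.pos _ _ h0
    simp only [map_sum, map_smul, sum_apply, smul_apply, smul_eq_mul] at this
    simp only [Matrix.mulVec, dotProduct, metricInChart_apply, star_trivial]
    refine this.trans_eq (Finset.sum_congr rfl fun i _ ↦ ?_)
    congr 1
    refine Finset.sum_congr rfl fun j _ ↦ ?_
    rw [g.symm, mul_comm]

theorem isLocalMetricOn (g : SmoothMetric d M) (x : M) :
    IsLocalMetricOn (metricInChart g x) (chartAt (EuclideanSpace ℝ (Fin d)) x).target where
  contDiffOn := contDiffOn_metricInChart g x
  symm _ _ _ _ := g.symm _ _ _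
  isUnit _ hy := (posDef_metricInChart g x hy).det_pos.ne'.isUnit

theorem contDiffOn_inChart (f : SmoothFun d M) (x : M) :
    ContDiffOn ℝ ∞ (inChart x f) (chartAt (EuclideanSpace ℝ (Fin d)) x).target := by
  rw [← contMDiffOn_iff_contDiffOn]
  exact f.contMDiff.comp_contMDiffOn (contMDiffOn_chart_symm (I := 𝓡 d) (x := x))

/-- The metric `e^{-2τ} g`. -/
def conformalMetric (g : SmoothMetric d M) (τ : SmoothFun d M) : SmoothMetric d M where
  inner x := Real.exp (-2 * τ x) • g.inner x
  symm x v w := by simp [g.symm x v w]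
  pos x v hv := by
    have := g.pos x v hv
    simp only [smul_apply, smul_eq_mul]
    positivity
  isVonNBounded x := by
    -- The unit ball of `e^{-2τ} g` at `x` is the unit ball of `g` dilated by `e^{τ(x)}`.
    have h := (g.isVonNBounded x).image
      (Real.exp (τ x) • ContinuousLinearMap.id ℝ (TangentSpace (𝓡 d) x))
    refine h.subset fun v (hv : Real.exp (-2 * τ x) * g.inner x v v < 1) ↦ ?_
    refine ⟨Real.exp (-τ x) • v, ?_, ?_⟩
    · have : Real.exp (-2 * τ x) = Real.exp (-τ x) * Real.exp (-τ x) := by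
        rw [← Real.exp_add]; ring_nf
      rw [this, mul_assoc] at hv
      simpa using hv
    · simp [smul_smul, ← Real.exp_add]
  contMDiff := by
    have h : ContMDiff (𝓡 d) 𝓘(ℝ, ℝ) ∞ fun x ↦ Real.exp (-2 * τ x) :=
      Real.contDiff_exp.contMDiff.comp (contMDiff_const.mul τ.contMDiff)
    exact h.smul_section g.contMDiff

/-- The coordinate fields do not involve the metric, so the equality is definitional. It carries the
coordinate formulas over to `M`. -/
theorem metricInChart_conformalMetric (g : SmoothMetric d M) (τ : SmoothFun d M) (x : M) :
    metricInChart (conformalMetric g τ) x = expScale (metricInChart g x) (inChart x τ) := by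
  ext y i j
  rfl

theorem gradInner_conformalMetric (g : SmoothMetric d M) (τ : SmoothFun d M) (f h : M → ℝ) (x : M) :
    gradInner (conformalMetric g τ) f h x = Real.exp (2 * τ x) * gradInner g f h x := by
  rw [gradInner, metricInChart_conformalMetric,
    (isLocalMetricOn g x).localGradInner_expScale (mem_chart_target _ x)]
  simp [gradInner, inChart]

theorem laplacian_conformalMetric (g : SmoothMetric d M) (τ : SmoothFun d M) (f : M → ℝ) (x : M) :
    laplacian (conformalMetric g τ) f x =
      Real.exp (2 * τ x) * (laplacian g f x - (d - 2) * gradInner g τ f x) := by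
  rw [laplacian, metricInChart_conformalMetric, (isLocalMetricOn g x).localLaplacian_expScale
    (chartAt _ x).open_target (contDiffOn_inChart τ x) (mem_chart_target _ x)]
  simp [gradInner, laplacian, inChart]

theorem scalarCurvature_conformalMetric (g : SmoothMetric d M) (τ : SmoothFun d M) (x : M) :
    scalarCurvature (conformalMetric g τ) x = Real.exp (2 * τ x) * (scalarCurvature g x +
      2 * (d - 1) * laplacian g τ x - (d - 1) * (d - 2) * gradInner g τ τ x) := by
  rw [scalarCurvature, metricInChart_conformalMetric,
    (isLocalMetricOn g x).localScalarCurvature_expScale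
    (chartAt _ x).open_target (contDiffOn_inChart τ x) (mem_chart_target _ x)]
  simp [gradInner, laplacian, inChart, scalarCurvature]

end

end WeightedManifold

/-! ### The Riemannian volume. -/

namespace WeightedManifold

section WithDensity

variable {α β : Type*} [MeasurableSpace α] [MeasurableSpace β]

theorem withDensity_mono_left {μ ν : Measure α} (h : μ ≤ ν) (f : α → ENNReal) :
    μ.withDensity f ≤ ν.withDensity f := by
  refine Measure.le_iff.2 fun s hs ↦ ?_
  rw [withDensity_apply _ hs, withDensity_apply _ hs]
  exact lintegral_mono' (Measure.restrict_mono le_rfl h) le_rfl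

/-- For `f` with values in `(0, ∞)`, taking the density `f` is an order automorphism of the
measures, with inverse the density `f⁻¹`; hence it commutes with suprema. -/
theorem withDensity_iSup {ι : Type*} (μ : ι → Measure α) {f : α → ENNReal} (hf : Measurable f)
    (h0 : ∀ x, f x ≠ 0) (htop : ∀ x, f x ≠ ⊤) :
    (⨆ i, μ i).withDensity f = ⨆ i, (μ i).withDensity f := by
  refine le_antisymm ?_ (iSup_le fun i ↦ withDensity_mono_left (le_iSup μ i) f)
  have h : ⨆ i, μ i ≤ (⨆ i, (μ i).withDensity f).withDensity (f⁻¹) := by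
    refine iSup_le fun i ↦ ?_
    calc μ i = ((μ i).withDensity f).withDensity (f⁻¹) :=
          (withDensity_inv_same hf (.of_forall h0) (.of_forall htop)).symm
      _ ≤ _ := withDensity_mono_left (le_iSup (fun i ↦ (μ i).withDensity f) i) _
  refine (withDensity_mono_left h f).trans_eq ?_
  have := withDensity_inv_same (μ := ⨆ i, (μ i).withDensity f) hf.inv
    (.of_forall fun x ↦ ENNReal.inv_ne_zero.2 (htop x))
    (.of_forall fun x ↦ ENNReal.inv_ne_top.2 (h0 x))
  simpa only [Pi.inv_apply, inv_inv] using this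

/-- Almost everywhere measurability is the right generality: an inverse chart is controlled only on
the target of the chart. -/
theorem withDensity_map {ν : Measure α} {φ : α → β} (hφ : AEMeasurable φ ν) {f : β → ENNReal}
    (hf : Measurable f) :
    (ν.map φ).withDensity f = (ν.withDensity (f ∘ φ)).map φ := by
  ext A hA
  have hn := hφ.nullMeasurableSet_preimage hA
  rw [withDensity_apply _ hA, ← lintegral_indicator hA, lintegral_map' (hf.indicator hA).aemeasurable
    hφ, Measure.map_apply_of_aemeasurable (hφ.mono_ac (withDensity_absolutelyContinuous _ _)) hA,
    withDensity_apply₀ _ hn, ← lintegral_indicator₀ hn]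
  rfl

end WithDensity

variable {d : ℕ} {M : Type*} [TopologicalSpace M] [ChartedSpace (EuclideanSpace ℝ (Fin d)) M]

local notation "E" => EuclideanSpace ℝ (Fin d)

section Measurability

variable [MeasurableSpace M] [BorelSpace M]

theorem aemeasurable_chart_symm (x : M) :
    AEMeasurable (chartAt E x).symm (volume.restrict (chartAt E x).target) :=
  (chartAt E x).continuousOn_symm.aemeasurable (chartAt E x).open_target.measurableSet

theorem measurableSet_chart_symm_preimage (x : M) {A : Set M} (hA : MeasurableSet A) :
    MeasurableSet ((chartAt E x).symm ⁻¹' A ∩ (chartAt E x).target) := by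
  have h : Measurable ((chartAt E x).target.domRestrict (chartAt E x).symm) :=
    (continuousOn_iff_continuous_domRestrict.1 (chartAt E x).continuousOn_symm).measurable
  have := (chartAt E x).open_target.measurableSet.subtype_image (h hA)
  convert this using 1
  ext z
  simp [Set.domRestrict, and_comm]

end Measurability

variable [IsManifold (𝓡 d) ∞ M]

/-- The density of the Riemannian volume in the preferred chart at `x`. -/
noncomputable def chartDensity (g : SmoothMetric d M) (x : M) (y : EuclideanSpace ℝ (Fin d)) :
    ENNReal :=
  ENNReal.ofReal (Real.sqrt (metricInChart g x y).det)

theorem continuousOn_chartDensity (g : SmoothMetric d M) (x : M) :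
    ContinuousOn (chartDensity g x) (chartAt E x).target :=
  ENNReal.continuous_ofReal.comp_continuousOn
    (contDiffOn_det (contDiffOn_metricInChart g x)).continuousOn.sqrt

theorem chartDensity_pos (g : SmoothMetric d M) (x : M) {y : EuclideanSpace ℝ (Fin d)}
    (hy : y ∈ (chartAt E x).target) : 0 < chartDensity g x y :=
  ENNReal.ofReal_pos.2 (Real.sqrt_pos.2 (posDef_metricInChart g x hy).det_pos)

/-- The determinant has degree `d`, so it scales by `e^{-2dτ}` and its square root by `e^{-dτ}`. -/
theorem chartDensity_conformalMetric (g : SmoothMetric d M) (τ : SmoothFun d M) (x : M)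
    (y : EuclideanSpace ℝ (Fin d)) :
    chartDensity (conformalMetric g τ) x y =
      chartDensity g x y * ENNReal.ofReal (Real.exp (-d * τ ((chartAt E x).symm y))) := by
  rw [chartDensity, metricInChart_conformalMetric, expScale, Matrix.det_smul, Fintype.card_fin,
    Real.sqrt_mul (by positivity), mul_comm, ENNReal.ofReal_mul (Real.sqrt_nonneg _), chartDensity]
  congr 2
  rw [Real.sqrt_eq_iff_mul_self_eq (by positivity) (by positivity), ← Real.exp_add,
    ← Real.exp_nat_mul]
  simp only [inChart]
  ring_nf

/-- The change of coordinates from the preferred chart at `y` to the one at `x`. -/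
noncomputable def transition (x y : M) (z : EuclideanSpace ℝ (Fin d)) :
    EuclideanSpace ℝ (Fin d) :=
  chartAt E x ((chartAt E y).symm z)

theorem differentiableAt_transition {x y : M} {z : EuclideanSpace ℝ (Fin d)}
    (hz : z ∈ (chartAt E y).target) (hx : (chartAt E y).symm z ∈ (chartAt E x).source) :
    DifferentiableAt ℝ (transition x y) z := by
  rw [← mdifferentiableAt_iff_differentiableAt]
  exact ((mdifferentiable_chart (I := 𝓡 d) x).mdifferentiableAt hx).comp z
    ((mdifferentiable_chart (I := 𝓡 d) y).mdifferentiableAt_symm hz)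

/-- Chain rule for the change of charts. The vectors are read in the model space because their base
points are equal only propositionally. -/
theorem mfderiv_chart_symm_eq {x y : M} {z : EuclideanSpace ℝ (Fin d)}
    (hz : z ∈ (chartAt E y).target) (hx : (chartAt E y).symm z ∈ (chartAt E x).source) (v : E) :
    (mfderiv 𝓘(ℝ, E) (𝓡 d) (chartAt E y).symm z v : E) =
      (mfderiv 𝓘(ℝ, E) (𝓡 d) (chartAt E x).symm (transition x y z)
        (fderiv ℝ (transition x y) z v) : E) := by
  have hev : (chartAt E y).symm =ᶠ[nhds z] (chartAt E x).symm ∘ transition x y := by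
    have h1 : ∀ᶠ w in nhds z, (chartAt E y).symm w ∈ (chartAt E x).source :=
      ((chartAt E y).continuousAt_symm hz).eventually ((chartAt E x).open_source.mem_nhds hx)
    filter_upwards [h1] with w hw
    exact ((chartAt E x).left_inv hw).symm
  have h2 := mfderiv_comp (I := 𝓘(ℝ, E)) (I' := 𝓘(ℝ, E)) (I'' := 𝓡 d) z
    ((mdifferentiable_chart (I := 𝓡 d) x).mdifferentiableAt_symm ((chartAt E x).map_source hx))
    (differentiableAt_transition hz hx).mdifferentiableAt
  have h3 := hev.mfderiv_eq (I := 𝓘(ℝ, E)) (I' := 𝓡 d)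
  rw [mfderiv_eq_fderiv] at h2
  exact congrArg (fun L : E →L[ℝ] E ↦ L v) (h3.trans h2)

/-- The Gram matrices of the two coordinate frames are related by `Jᵀ G J`, with `J` the Jacobian
matrix of the transition map. -/
theorem det_metricInChart_transition (g : SmoothMetric d M) {x y : M}
    {z : EuclideanSpace ℝ (Fin d)}
    (hz : z ∈ (chartAt E y).target) (hx : (chartAt E y).symm z ∈ (chartAt E x).source) :
    (metricInChart g y z).det =
      (fderiv ℝ (transition x y) z).det ^ 2 * (metricInChart g x (transition x y z)).det := by
  set b := (EuclideanSpace.basisFun (Fin d) ℝ).toBasis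
  set J := LinearMap.toMatrix b b (fderiv ℝ (transition x y) z).toLinearMap with hJ
  have hdet : (fderiv ℝ (transition x y) z).det = J.det := (LinearMap.det_toMatrix b _).symm
  have hp : ∀ p, p = (chartAt E y).symm z → ∀ v w : E,
      (g.inner p v w : ℝ) = g.inner ((chartAt E y).symm z) v w := by
    rintro _ rfl _ _; rfl
  have hc : ∀ i, (coordVec y z i : E) = ∑ a, J a i • (coordVec x (transition x y z) a : E) := by
    intro i
    have h1 : fderiv ℝ (transition x y) z (EuclideanSpace.single i 1) =
        ∑ a, J a i • (EuclideanSpace.single a 1 : E) := by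
      have := b.sum_repr (fderiv ℝ (transition x y) z (b i))
      simp only [hJ, LinearMap.toMatrix_apply]
      simpa [b] using this.symm
    have h2 := mfderiv_chart_symm_eq hz hx (EuclideanSpace.single i 1)
    rw [h1] at h2
    refine h2.trans ?_
    refine (map_sum (mfderiv 𝓘(ℝ, E) (𝓡 d) (chartAt E x).symm (transition x y z)) _ _).trans ?_
    exact Finset.sum_congr rfl fun a _ ↦ map_smul _ _ _
  have hG : metricInChart g y z = J.transpose * metricInChart g x (transition x y z) * J := by
    ext i j
    have hm : ∀ a c, metricInChart g x (transition x y z) a c =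
        g.inner ((chartAt E y).symm z) (coordVec x (transition x y z) a : E)
          (coordVec x (transition x y z) c : E) := fun a c ↦
      hp _ ((chartAt E x).left_inv hx) _ _
    simp only [Matrix.mul_apply, Matrix.transpose_apply, hm]
    set B : E →L[ℝ] E →L[ℝ] ℝ := g.inner ((chartAt E y).symm z)
    change B (coordVec y z i : E) (coordVec y z j : E) = _
    have hB : ∀ u : Fin d → E, B (∑ a, J a i • u a) (∑ c, J c j • u c) =
        ∑ c, (∑ a, J a i * B (u a) (u c)) * J c j := by
      intro u
      simp only [map_sum, map_smul, sum_apply, smul_apply, smul_eq_mul, Finset.sum_mul,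
        Finset.mul_sum]
      exact Finset.sum_congr rfl fun c _ ↦ Finset.sum_congr rfl fun a _ ↦ by ring
    exact (congrArg₂ (fun v w : E ↦ B v w) (hc i) (hc j)).trans (hB _)
  rw [hG, Matrix.det_mul, Matrix.det_mul, Matrix.det_transpose, hdet]
  ring

theorem chartDensity_transition (g : SmoothMetric d M) {x y : M} {z : EuclideanSpace ℝ (Fin d)}
    (hz : z ∈ (chartAt E y).target) (hx : (chartAt E y).symm z ∈ (chartAt E x).source) :
    chartDensity g y z = ENNReal.ofReal |(fderiv ℝ (transition x y) z).det| *
      chartDensity g x (transition x y z) := by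
  rw [chartDensity, chartDensity, det_metricInChart_transition g hz hx,
    Real.sqrt_mul (sq_nonneg _), Real.sqrt_sq_eq_abs, ENNReal.ofReal_mul (abs_nonneg _)]

theorem aemeasurable_chartDensity (g : SmoothMetric d M) (x : M) :
    AEMeasurable (chartDensity g x) (volume.restrict (chartAt E x).target) :=
  (continuousOn_chartDensity g x).aemeasurable (chartAt E x).open_target.measurableSet

section Volume

variable [MeasurableSpace M] [BorelSpace M]

theorem chartVolume_apply (g : SmoothMetric d M) (x : M) {A : Set M} (hA : MeasurableSet A) :
    chartVolume g x A =
      ∫⁻ y in (chartAt E x).symm ⁻¹' A ∩ (chartAt E x).target, chartDensity g x y := by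
  rw [chartVolume, Measure.map_apply_of_aemeasurable ((aemeasurable_chart_symm x).mono_ac
    (withDensity_absolutelyContinuous _ _)) hA, withDensity_apply',
    Measure.restrict_restrict' (chartAt E x).open_target.measurableSet]
  rfl

theorem chartVolume_conformalMetric (g : SmoothMetric d M) (τ : SmoothFun d M) (x : M) :
    chartVolume (conformalMetric g τ) x =
      (chartVolume g x).withDensity fun p ↦ ENNReal.ofReal (Real.exp (-d * τ p)) := by
  have hf : Measurable fun p ↦ ENNReal.ofReal (Real.exp (-d * τ p)) := by
    have hτ : Continuous τ := τ.contMDiff.continuous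
    fun_prop
  have hs := aemeasurable_chart_symm (d := d) x
  simp only [chartVolume]
  rw [withDensity_map (hs.mono_ac (withDensity_absolutelyContinuous _ _)) hf]
  congr 1
  refine Eq.trans ?_ (withDensity_mul₀ (aemeasurable_chartDensity g x)
    (hf.comp_aemeasurable hs))
  congr 1
  ext1 y
  exact (chartDensity_conformalMetric g τ x y)

theorem riemannianVolume_conformalMetric (g : SmoothMetric d M) (τ : SmoothFun d M) :
    riemannianVolume (conformalMetric g τ) =
      (riemannianVolume g).withDensity fun p ↦ ENNReal.ofReal (Real.exp (-d * τ p)) := by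
  have hf : Measurable fun p ↦ ENNReal.ofReal (Real.exp (-d * τ p)) := by
    have hτ : Continuous τ := τ.contMDiff.continuous
    fun_prop
  simp only [riemannianVolume, chartVolume_conformalMetric]
  rw [withDensity_iSup _ hf]
  · exact fun p ↦ (ENNReal.ofReal_pos.2 (Real.exp_pos _)).ne'
  · exact fun p ↦ ENNReal.ofReal_ne_top

/-- Half of the fact that the chart volumes agree on overlaps. -/
theorem chartVolume_restrict_le (g : SmoothMetric d M) (x y : M) :
    (chartVolume g y).restrict (chartAt E x).source ≤ chartVolume g x := by
  refine Measure.le_iff.2 fun A hA ↦ ?_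
  have hA' := hA.inter (chartAt E x).open_source.measurableSet
  rw [Measure.restrict_apply hA, chartVolume_apply g y hA', chartVolume_apply g x hA]
  set B := (chartAt E y).symm ⁻¹' (A ∩ (chartAt E x).source) ∩ (chartAt E y).target
  have hB : MeasurableSet B := measurableSet_chart_symm_preimage y hA'
  have hinj : Set.InjOn (transition x y) B := by
    intro z hz w hw h
    exact (chartAt E y).symm.injOn hz.2 hw.2 ((chartAt E x).injOn hz.1.2 hw.1.2 h)
  calc ∫⁻ z in B, chartDensity g y z
      = ∫⁻ z in B, ENNReal.ofReal |(fderiv ℝ (transition x y) z).det| *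
          chartDensity g x (transition x y z) :=
        setLIntegral_congr_fun hB fun z hz ↦ chartDensity_transition g hz.2 hz.1.2
    _ = ∫⁻ z in transition x y '' B, chartDensity g x z :=
        (lintegral_image_eq_lintegral_abs_det_fderiv_mul volume hB (fun z hz ↦
          (differentiableAt_transition hz.2 hz.1.2).hasFDerivAt.hasFDerivWithinAt) hinj _).symm
    _ ≤ _ := by
        refine lintegral_mono_set ?_
        rintro _ ⟨z, hz, rfl⟩
        refine ⟨?_, (chartAt E x).map_source hz.1.2⟩
        simp only [Set.mem_preimage, transition]
        rw [(chartAt E x).left_inv hz.1.2]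
        exact hz.1.1

/-- The chart measure at `x` plus the part of `V_g` off the chart domain dominates every chart
measure, hence their supremum; the second summand does not charge `A`. -/
theorem riemannianVolume_le_chartVolume (g : SmoothMetric d M) (x : M) {A : Set M}
    (hA : MeasurableSet A) (hx : A ⊆ (chartAt E x).source) :
    riemannianVolume g A ≤ chartVolume g x A := by
  have hS := (chartAt E x).open_source.measurableSet
  have h : riemannianVolume g ≤
      chartVolume g x + (riemannianVolume g).restrict (chartAt E x).sourceᶜ := by
    refine iSup_le fun y ↦ ?_
    rw [← Measure.restrict_add_restrict_compl (μ := chartVolume g y) hS]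
    exact add_le_add (chartVolume_restrict_le g x y)
      (Measure.restrict_mono le_rfl (le_iSup (chartVolume g) y))
  refine (h A).trans_eq ?_
  rw [Measure.add_apply, Measure.restrict_apply hA, ← Set.sdiff_eq, Set.sdiff_eq_empty.2 hx]
  simp

/-- Near a point `V_g` is bounded by a single chart measure, whose density is locally bounded.
Together with second countability this yields σ-finiteness. -/
instance isLocallyFiniteMeasure_riemannianVolume (g : SmoothMetric d M) :
    IsLocallyFiniteMeasure (riemannianVolume g) := by
  refine ⟨fun x ↦ ?_⟩
  set φ := chartAt E x
  have hφx : φ x ∈ φ.target := mem_chart_target _ x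
  have hcont : ContinuousAt (chartDensity g x) (φ x) :=
    (continuousOn_chartDensity g x).continuousAt (φ.open_target.mem_nhds hφx)
  have h1 : ∀ᶠ z in nhds (φ x), chartDensity g x z < chartDensity g x (φ x) + 1 :=
    hcont.eventually (Iio_mem_nhds (ENNReal.lt_add_right ENNReal.ofReal_ne_top one_ne_zero))
  obtain ⟨r, hr, hV⟩ := Metric.eventually_nhds_iff_ball.1 h1
  have hopen : IsOpen (φ.source ∩ φ ⁻¹' Metric.ball (φ x) r) :=
    φ.isOpen_inter_preimage Metric.isOpen_ball
  refine ⟨_, hopen.mem_nhds ⟨mem_chart_source _ x, Metric.mem_ball_self hr⟩, ?_⟩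
  refine (riemannianVolume_le_chartVolume g x hopen.measurableSet Set.inter_subset_left).trans_lt ?_
  rw [chartVolume_apply g x hopen.measurableSet]
  have hsub : φ.symm ⁻¹' (φ.source ∩ φ ⁻¹' Metric.ball (φ x) r) ∩ φ.target ⊆
      Metric.ball (φ x) r := by
    rintro z ⟨⟨_, hz⟩, hzt⟩
    rwa [Set.mem_preimage, φ.right_inv hzt] at hz
  refine (lintegral_mono_set hsub).trans_lt ?_
  refine (setLIntegral_mono' (g := fun _ ↦ chartDensity g x (φ x) + 1)
    Metric.isOpen_ball.measurableSet fun z hz ↦ (hV z hz).le).trans_lt ?_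
  rw [setLIntegral_const]
  exact ENNReal.mul_lt_top (ENNReal.add_lt_top.2 ⟨ENNReal.ofReal_lt_top, ENNReal.one_lt_top⟩)
    measure_ball_lt_top

instance isOpenPosMeasure_riemannianVolume (g : SmoothMetric d M) :
    (riemannianVolume g).IsOpenPosMeasure := by
  refine ⟨fun U hU ⟨x, hx⟩ h0 ↦ ?_⟩
  have h1 : chartVolume g x U = 0 :=
    le_antisymm ((le_iSup (chartVolume g) x U).trans_eq h0) zero_le
  have hopen : IsOpen ((chartAt E x).symm ⁻¹' U ∩ (chartAt E x).target) := by
    rw [Set.inter_comm]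
    exact (chartAt E x).isOpen_inter_preimage_symm hU
  rw [chartVolume_apply g x hU.measurableSet, lintegral_eq_zero_iff'
    ((aemeasurable_chartDensity g x).mono_set Set.inter_subset_right)] at h1
  have h2 := (ae_restrict_iff' hopen.measurableSet).1 h1
  have h3 : volume ((chartAt E x).symm ⁻¹' U ∩ (chartAt E x).target) = 0 := by
    refine measure_mono_null (fun z hz ↦ ?_) h2
    simpa [hz.2] using ⟨hz.1, (chartDensity_pos g x hz.2).ne'⟩
  refine (hopen.measure_pos volume ⟨chartAt E x x, ?_, mem_chart_target _ x⟩).ne' h3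
  simpa using hx

end Volume

end WeightedManifold

/-! ### The carré du champ determines the metric. -/

namespace WeightedManifold

variable {d : ℕ} {M : Type*} [TopologicalSpace M] [ChartedSpace (EuclideanSpace ℝ (Fin d)) M]
  [IsManifold (𝓡 d) ∞ M]

local notation "E" => EuclideanSpace ℝ (Fin d)

/-- There are smooth functions with prescribed partial derivatives at a point. -/
theorem exists_smoothFun_pderiv_eq [T2Space M] (x : M) (v : EuclideanSpace ℝ (Fin d)) :
    ∃ f : SmoothFun d M, ∀ k, pderiv k (inChart x f) (chartAt E x x) = v k := by
  obtain ⟨ρ⟩ : Nonempty (SmoothBumpFunction (𝓡 d) x) := inferInstance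
  let ℓ : E →L[ℝ] ℝ := innerSL ℝ v
  have hℓ : ContMDiffOn (𝓡 d) 𝓘(ℝ, ℝ) ∞ (fun p ↦ ℓ (chartAt E x p)) (chartAt E x).source :=
    ℓ.contDiff.contMDiff.comp_contMDiffOn (contMDiffOn_chart (I := 𝓡 d) (x := x))
  refine ⟨⟨fun p ↦ ρ p • ℓ (chartAt E x p), ρ.contMDiff_smul hℓ⟩, fun k ↦ ?_⟩
  have h1 : ∀ᶠ z in nhds (chartAt E x x), ρ ((chartAt E x).symm z) = 1 := by
    have h := (chartAt E x).continuousAt_symm (mem_chart_target E x)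
    rw [ContinuousAt, (chartAt E x).left_inv (mem_chart_source E x)] at h
    exact h.eventually ρ.eventuallyEq_one
  have h2 : (fun z ↦ ρ ((chartAt E x).symm z) • ℓ (chartAt E x ((chartAt E x).symm z)))
      =ᶠ[nhds (chartAt E x x)] ℓ := by
    filter_upwards [h1, (chartAt E x).open_target.mem_nhds (mem_chart_target E x)] with z hz hzt
    rw [hz, (chartAt E x).right_inv hzt, one_smul]
  refine (pderiv_congr h2).trans ?_
  rw [pderiv, ContinuousLinearMap.fderiv]
  simp [ℓ, EuclideanSpace.inner_single_right]

/-- Polarization with the vectors `e_a + e_b`; the case `a = b` gives the diagonal entries. -/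
theorem eq_of_quadratic_eq {ι : Type*} [Fintype ι] [DecidableEq ι] {A B : Matrix ι ι ℝ}
    (hA : ∀ i j, A i j = A j i) (hB : ∀ i j, B i j = B j i)
    (h : ∀ v : ι → ℝ, ∑ i, ∑ j, A i j * (v i * v j) = ∑ i, ∑ j, B i j * (v i * v j)) : A = B := by
  have key : ∀ (C : Matrix ι ι ℝ) (a b : ι), ∑ i, ∑ j, C i j *
      (((Pi.single a 1 : ι → ℝ) i + (Pi.single b 1 : ι → ℝ) i) *
        ((Pi.single a 1 : ι → ℝ) j + (Pi.single b 1 : ι → ℝ) j)) =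
      C a a + C a b + C b a + C b b := by
    intro C a b
    simp only [mul_add, Finset.sum_add_distrib, Pi.single_apply, mul_ite, mul_one, mul_zero,
      Finset.sum_ite_eq', Finset.mem_univ, if_true]
    ring
  have hk : ∀ a b, A a a + A a b + A b a + A b b = B a a + B a b + B b a + B b b := fun a b ↦ by
    rw [← key, ← key]
    exact h fun i ↦ (Pi.single a 1 : ι → ℝ) i + (Pi.single b 1 : ι → ℝ) i
  ext a b
  linarith [hk a b, hk a a, hk b b, hA a b, hB a b]

/-- At a point `Γ(f)` is the quadratic form of `G⁻¹` at the differential of `f`, which can be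
prescribed; so the inverse matrices agree, then the matrices, then the inner products on the
coordinate frame. -/
theorem metric_eq_of_gradInner_eq [T2Space M] {g h : SmoothMetric d M}
    (hgh : ∀ (f : SmoothFun d M) (x : M), gradInner g f f x = gradInner h f f x) : g = h := by
  have hinner : ∀ x, g.inner x = h.inner x := by
    intro x
    have hx : chartAt E x x ∈ (chartAt E x).target := mem_chart_target E x
    have hinv : (metricInChart g x (chartAt E x x))⁻¹ = (metricInChart h x (chartAt E x x))⁻¹ := by
      refine eq_of_quadratic_eq ((isLocalMetricOn g x).inv_symm hx)
        ((isLocalMetricOn h x).inv_symm hx) fun v ↦ ?_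
      obtain ⟨f, hf⟩ := exists_smoothFun_pderiv_eq x (WithLp.toLp 2 v)
      simpa only [gradInner, localGradInner, hf] using hgh f x
    have hG : metricInChart g x (chartAt E x x) = metricInChart h x (chartAt E x x) := by
      rw [← Matrix.nonsing_inv_nonsing_inv _ ((isLocalMetricOn g x).isUnit _ hx), hinv,
        Matrix.nonsing_inv_nonsing_inv _ ((isLocalMetricOn h x).isUnit _ hx)]
    -- The coordinate frame lives over `φ.symm (φ x)`, which equals `x` only propositionally.
    have hp : ∀ p, g.inner p = h.inner p → p = x → g.inner x = h.inner x := by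
      rintro p hp rfl
      exact hp
    refine hp _ ?_ ((chartAt E x).left_inv (mem_chart_source E x))
    have : FiniteDimensional ℝ (TangentSpace (𝓡 d) ((chartAt E x).symm (chartAt E x x))) :=
      inferInstanceAs (FiniteDimensional ℝ E)
    have hspan := (linearIndependent_coordVec x hx).span_eq_top_of_card_eq_finrank'
      (by rw [Fintype.card_fin]; exact (finrank_euclideanSpace_fin (𝕜 := ℝ) (n := d)).symm)
    let b := Module.Basis.mk (linearIndependent_coordVec x hx) hspan.ge
    refine ContinuousLinearMap.coe_injective (b.ext fun i ↦ ?_)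
    refine ContinuousLinearMap.coe_injective (b.ext fun j ↦ ?_)
    simp only [b, Module.Basis.mk_apply]
    exact congrFun (congrFun hG i) j
  obtain ⟨_, _, _, _, _⟩ := g
  obtain ⟨_, _, _, _, _⟩ := h
  congr
  exact funext hinner

/-! ### Linearity and the transformation law of the formula. -/

section Linearity

variable {F H : EuclideanSpace ℝ (Fin d) → ℝ}
  {G : EuclideanSpace ℝ (Fin d) → Matrix (Fin d) (Fin d) ℝ}
  {U : Set (EuclideanSpace ℝ (Fin d))} {y : EuclideanSpace ℝ (Fin d)}

theorem pderiv_add_const_mul (hU : IsOpen U) (hF : ContDiffOn ℝ ∞ F U) (hH : ContDiffOn ℝ ∞ H U)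
    (hy : y ∈ U) (a : ℝ) (k : Fin d) :
    pderiv k (fun z ↦ F z + a * H z) y = pderiv k F y + a * pderiv k H y := by
  have hd : ∀ {f : EuclideanSpace ℝ (Fin d) → ℝ}, ContDiffOn ℝ ∞ f U → DifferentiableAt ℝ f y :=
    fun hf ↦ (hf.contDiffAt (hU.mem_nhds hy)).differentiableAt (by simp)
  rw [pderiv_add (hd hF) ((hd hH).const_mul a), pderiv_const_mul a (hd hH)]

theorem localLaplacian_add_const_mul (hU : IsOpen U) (hF : ContDiffOn ℝ ∞ F U)
    (hH : ContDiffOn ℝ ∞ H U) (hy : y ∈ U) (a : ℝ) :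
    localLaplacian G (fun z ↦ F z + a * H z) y = localLaplacian G F y + a * localLaplacian G H y := by
  have h2 : ∀ i j, pderiv i (pderiv j fun z ↦ F z + a * H z) y =
      pderiv i (pderiv j F) y + a * pderiv i (pderiv j H) y := fun i j ↦
    (pderiv_congr (Filter.eventuallyEq_of_mem (hU.mem_nhds hy) fun z hz ↦
      pderiv_add_const_mul hU hF hH hz a j)).trans
      (pderiv_add_const_mul hU (hF.pderiv hU j) (hH.pderiv hU j) hy a i)
  simp only [localLaplacian, h2, pderiv_add_const_mul hU hF hH hy, Finset.mul_sum,
    ← Finset.sum_add_distrib]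
  refine Finset.sum_congr rfl fun i _ ↦ Finset.sum_congr rfl fun j _ ↦ ?_
  simp only [mul_add, Finset.sum_add_distrib, mul_left_comm _ a, ← Finset.mul_sum]
  ring

theorem localGradInner_add_const_mul_right {K : EuclideanSpace ℝ (Fin d) → ℝ} (hU : IsOpen U)
    (hF : ContDiffOn ℝ ∞ F U) (hH : ContDiffOn ℝ ∞ H U) (hy : y ∈ U) (a : ℝ) :
    localGradInner G K (fun z ↦ F z + a * H z) y =
      localGradInner G K F y + a * localGradInner G K H y := by
  simp only [localGradInner, pderiv_add_const_mul hU hF hH hy, Finset.mul_sum,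
    ← Finset.sum_add_distrib]
  exact Finset.sum_congr rfl fun i _ ↦ Finset.sum_congr rfl fun j _ ↦ by ring

theorem IsLocalMetricOn.localGradInner_comm (hG : IsLocalMetricOn G U) (hy : y ∈ U) :
    localGradInner G F H y = localGradInner G H F y := by
  rw [localGradInner, Finset.sum_comm, localGradInner]
  refine Finset.sum_congr rfl fun i _ ↦ Finset.sum_congr rfl fun j _ ↦ ?_
  rw [hG.inv_symm hy i j, mul_comm (pderiv i H y)]

end Linearity

theorem laplacian_add_const_mul (g : SmoothMetric d M) (f h : SmoothFun d M) (a : ℝ) (x : M) :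
    laplacian g (fun p ↦ f p + a * h p) x = laplacian g f x + a * laplacian g h x :=
  localLaplacian_add_const_mul (chartAt E x).open_target (contDiffOn_inChart f x)
    (contDiffOn_inChart h x) (mem_chart_target E x) a

theorem gradInner_comm (g : SmoothMetric d M) (f h : M → ℝ) (x : M) :
    gradInner g f h x = gradInner g h f x :=
  (isLocalMetricOn g x).localGradInner_comm (mem_chart_target E x)

theorem gradInner_add_const_mul_right (g : SmoothMetric d M) (u f h : SmoothFun d M)
    (a : ℝ) (x : M) :
    gradInner g u (fun p ↦ f p + a * h p) x = gradInner g u f x + a * gradInner g u h x :=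
  localGradInner_add_const_mul_right (chartAt E x).open_target (contDiffOn_inChart f x)
    (contDiffOn_inChart h x) (mem_chart_target E x) a

/-- The metric and weight of the pair `(c^{-n} μ, c² Γ)` with `c = e^τ`. -/
noncomputable def WeightedStructure.conformal (X : WeightedStructure d M) (n : ℝ)
    (τ : SmoothFun d M) : WeightedStructure d M where
  metric := conformalMetric X.metric τ
  -- Solves `e^{-nτ} e^{-W} dV = e^{-W'} e^{-dτ} dV` for the new weight `W'`.
  weight := ⟨fun x ↦ X.weight x + (n - d) * τ x,
    X.weight.contMDiff.add (contMDiff_const.mul τ.contMDiff)⟩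

/-- Let `A = 2(d-1) - γ(n-d)`. In the bracket the new terms are `A Δτ`, then `(γ(d-2) + 2β(n-d))
Γ(W, τ)`, which is `-A Γ(W, τ)` by the choice of `β`, and finally a multiple of `Γ(τ)` whose
coefficient is then `-A (n-2)/2`. Their sum is `A (Lτ - (n-2)/2 Γ(τ))`, and `θ A = (n-2)/2`. -/
theorem invariantFormula_conformal {n γ : ℝ} (hn : (d : ℝ) < n)
    (hγ : 4 * ((d : ℝ) - 1) - 2 * γ * (n - d) ≠ 0) (Y : WeightedStructure d M) (τ : SmoothFun d M)
    (x : M) :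
    invariantFormula n γ (Y.conformal n τ) x = Real.exp (2 * τ x) * (invariantFormula n γ Y x +
      (n - 2) / 2 * (Y.generator τ x - (n - 2) / 2 * gradInner Y.metric τ τ x)) := by
  have hn' : n - d ≠ 0 := (sub_pos.2 hn).ne'
  have hL := laplacian_add_const_mul Y.metric Y.weight τ (n - d) x
  have hI : gradInner Y.metric (fun p ↦ Y.weight p + (n - d) * τ p)
      (fun p ↦ Y.weight p + (n - d) * τ p) x = gradInner Y.metric Y.weight Y.weight x +
      2 * (n - d) * gradInner Y.metric Y.weight τ x + (n - d) ^ 2 * gradInner Y.metric τ τ x := by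
    have e := gradInner_add_const_mul_right Y.metric (Y.conformal n τ).weight Y.weight τ (n - d) x
    have e1 := gradInner_add_const_mul_right Y.metric Y.weight Y.weight τ (n - d) x
    have e2 := gradInner_add_const_mul_right Y.metric τ Y.weight τ (n - d) x
    change gradInner Y.metric (fun p ↦ Y.weight p + (n - d) * τ p) _ x = _ at e
    rw [e, gradInner_comm Y.metric (Y.conformal n τ).weight, gradInner_comm Y.metric _ τ]
    change gradInner Y.metric Y.weight (fun p ↦ Y.weight p + (n - d) * τ p) x +
      (n - d) * gradInner Y.metric τ (fun p ↦ Y.weight p + (n - d) * τ p) x = _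
    rw [e1, e2, gradInner_comm Y.metric τ Y.weight]
    ring
  have hT := gradInner_add_const_mul_right Y.metric τ Y.weight τ (n - d) x
  rw [gradInner_comm Y.metric τ Y.weight] at hT
  have h1 : invariantFormula n γ (Y.conformal n τ) x = theta d n γ *
      (scalarCurvature (conformalMetric Y.metric τ) x
        - γ * laplacian (conformalMetric Y.metric τ) (fun p ↦ Y.weight p + (n - d) * τ p) x
        + beta d n γ * gradInner (conformalMetric Y.metric τ)
          (fun p ↦ Y.weight p + (n - d) * τ p) (fun p ↦ Y.weight p + (n - d) * τ p) x) := rfl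
  rw [h1, scalarCurvature_conformalMetric, laplacian_conformalMetric, gradInner_conformalMetric,
    hL, hI, hT, invariantFormula, WeightedStructure.generator, theta, beta]
  field_simp
  ring

/-! ### The correspondence between pairs and weighted structures. -/

variable [MeasurableSpace M] [BorelSpace M]

/-- By σ-finiteness the densities agree almost everywhere; being continuous, they agree everywhere,
since `V_g` charges every nonempty open set. -/
theorem weight_eq_of_withDensity_eq [SecondCountableTopology M] (g : SmoothMetric d M)
    {V W : SmoothFun d M}
    (h : (riemannianVolume g).withDensity (fun x ↦ ENNReal.ofReal (Real.exp (-V x))) =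
      (riemannianVolume g).withDensity fun x ↦ ENNReal.ofReal (Real.exp (-W x))) : V = W := by
  have hc : ∀ F : SmoothFun d M, Continuous fun x ↦ ENNReal.ofReal (Real.exp (-F x)) := fun F ↦
    ENNReal.continuous_ofReal.comp (Real.continuous_exp.comp F.contMDiff.continuous.neg)
  rw [withDensity_eq_iff_of_sigmaFinite (hc V).aemeasurable (hc W).aemeasurable,
    Continuous.ae_eq_iff_eq _ (hc V) (hc W)] at h
  ext x
  have := congrFun h x
  rw [ENNReal.ofReal_eq_ofReal_iff (Real.exp_pos _).le (Real.exp_pos _).le, Real.exp_eq_exp] at this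
  exact neg_injective this

/-- This is the well-definedness of `S_γ`: the choice in `SGamma` is among a single candidate. The
metric has to be identified before the weights can be compared. -/
theorem WeightedStructure.toPair_injective [T2Space M] [SecondCountableTopology M] :
    Function.Injective (toPair : WeightedStructure d M → MeasureCarre d M) := by
  rintro ⟨g, V⟩ ⟨h, W⟩ hgh
  have h1 : g = h := metric_eq_of_gradInner_eq fun f x ↦
    congrFun (congrFun (congrArg MeasureCarre.carre hgh) f) x
  subst h1
  have h2 : V = W := weight_eq_of_withDensity_eq g (congrArg MeasureCarre.measure hgh)
  rw [h2]

theorem SGamma_toPair [T2Space M] [SecondCountableTopology M] (n γ : ℝ)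
    (Y : WeightedStructure d M) : SGamma n γ Y.toPair = invariantFormula n γ Y := by
  have h : ∃ X : WeightedStructure d M, X.toPair = Y.toPair := ⟨Y, rfl⟩
  rw [SGamma, dif_pos h, WeightedStructure.toPair_injective h.choose_spec]

theorem WeightedStructure.toPair_conformal (X : WeightedStructure d M) (n : ℝ)
    {c τ : SmoothFun d M} (hc : ∀ x, c x = Real.exp (τ x)) :
    (X.conformal n τ).toPair = X.toPair.conformal n c := by
  have hW : Continuous X.weight := X.weight.contMDiff.continuous
  have hτ : Continuous τ := τ.contMDiff.continuous
  ext1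
  · change (riemannianVolume (conformalMetric X.metric τ)).withDensity (fun x ↦
      ENNReal.ofReal (Real.exp (-(X.weight x + (n - d) * τ x)))) =
      ((riemannianVolume X.metric).withDensity fun x ↦
        ENNReal.ofReal (Real.exp (-X.weight x))).withDensity fun x ↦ ENNReal.ofReal (c x ^ (-n))
    simp only [hc, ← Real.exp_mul]
    rw [riemannianVolume_conformalMetric, ← withDensity_mul _ (by fun_prop) (by fun_prop),
      ← withDensity_mul _ (by fun_prop) (by fun_prop)]
    congr 1
    ext1 x
    simp only [Pi.mul_apply]
    rw [← ENNReal.ofReal_mul (Real.exp_pos _).le, ← ENNReal.ofReal_mul (Real.exp_pos _).le,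
      ← Real.exp_add, ← Real.exp_add]
    ring_nf
  · ext f x
    change gradInner (conformalMetric X.metric τ) f f x = c x ^ 2 * gradInner X.metric f f x
    rw [gradInner_conformalMetric, hc, ← Real.exp_nat_mul]
    norm_num

theorem exists_toPair_eq_of_mem_nConformalClass {n : ℝ} {X : WeightedStructure d M}
    {T : MeasureCarre d M} (hT : T ∈ nConformalClass n X.toPair) :
    ∃ Y : WeightedStructure d M, Y.toPair = T := by
  obtain ⟨c, hc, rfl⟩ := hT
  -- The witness is the conformal change with `τ = log c`, smooth because `c` is positive.
  have hlog : ContMDiff (𝓡 d) 𝓘(ℝ, ℝ) ∞ fun x ↦ Real.log (c x) := fun x ↦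
    (Real.contDiffAt_log.2 (hc x).ne').contMDiffAt.comp x (c.contMDiff x)
  exact ⟨X.conformal n ⟨_, hlog⟩, X.toPair_conformal n fun x ↦ (Real.exp_log (hc x)).symm⟩

end WeightedManifold

theorem proposition3 {d : ℕ} (hd : 2 ≤ d)
    {M : Type*} [TopologicalSpace M] [T2Space M] [SecondCountableTopology M]
    [ChartedSpace (EuclideanSpace ℝ (Fin d)) M] [IsManifold (𝓡 d) ∞ M]
    [MeasurableSpace M] [BorelSpace M]
    (n γ : ℝ) (hn : (d : ℝ) < n) (hγ : 4 * ((d : ℝ) - 1) - 2 * γ * (n - d) ≠ 0)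
    (X : WeightedManifold.WeightedStructure d M) :
    (∀ T ∈ WeightedManifold.nConformalClass n X.toPair,
      ∃ Y : WeightedManifold.WeightedStructure d M, Y.toPair = T) ∧
    (∀ (Y : WeightedManifold.WeightedStructure d M) (x : M),
      WeightedManifold.SGamma n γ Y.toPair x =
        WeightedManifold.theta d n γ *
          (WeightedManifold.scalarCurvature Y.metric x
            - γ * WeightedManifold.laplacian Y.metric Y.weight x
            + WeightedManifold.beta d n γ *
              WeightedManifold.gradInner Y.metric Y.weight Y.weight x)) ∧
    WeightedManifold.IsNConformalInvariant n X (WeightedManifold.SGamma n γ) := by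
  refine ⟨fun T hT ↦ WeightedManifold.exists_toPair_eq_of_mem_nConformalClass hT, fun Y x ↦ ?_, ?_⟩
  · rw [WeightedManifold.SGamma_toPair, WeightedManifold.invariantFormula]
  · intro Y _ c _ τ hτ x
    -- Once the transformed pair is recognized as that of `Y.conformal n τ`, both values of `SGamma`
    -- are given by the formula.
    rw [← Y.toPair_conformal n hτ, WeightedManifold.SGamma_toPair, WeightedManifold.SGamma_toPair,
      WeightedManifold.invariantFormula_conformal hn hγ, hτ, ← Real.exp_nat_mul]
    norm_num
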